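/- Let $k$ be an algebraically closed field and let $Q_1$ be the quiver with three vertices $b,\mathrm{mid},e$ and three arrows $b\to e$, $b\to \mathrm{mid}$, $\mathrm{mid}\to e$. Let $Rep_k(Q_1)$ be the category of finite-dimensional $k$-representations of $Q_1$. Write $\hom(X,Y)=\dim_k\mathrm{Hom}(X,Y)$ and $\hom^1(X,Y)=\dim_k \mathrm{Ext}^1(X,Y)$; an object $X$ is exceptional if $\mathrm{Hom}(X,X)= k$ and $\mathrm{Ext}^i(X,X)=0$ for all $i\ge 1$. Denote by $[V_b,V_{mid},V_e;\,f,g,h]$ the representation with spaces $V_b,V_{mid},V_e$ at $b,\mathrm{mid},e$ and maps $f:V_b\to V_e$, $g:V_b\to V_{mid}$, $h:V_{mid}\to V_e$. For $m\ge 0$ define $\pi_+^m,\pi_-^m:k^{m+1}\to k^m$ and $j_+^m,j_-^m:k^m\to k^{m+1}$ by $\pi_+^m(a_1,\dots,a_{m+1})=(a_1,\dots,a_m)$, $\pi_-^m(a_1,\dots,a_{m+1})=(a_2,\dots,a_{m+1})$, $j_+^m(a_1,\dots,a_m)=(a_1,\dots,a_m,0)$, $j_-^m(a_1,\dots,a_m)=(0,a_1,\dots,a_m)$,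 and put $$E_1^m=[k^{m+1},k^m,k^m;\pi_+^m,\pi_-^m,\mathrm{Id}],\qquad E_2^m=[k^{m},k^{m+1},k^{m+1};j_+^m,j_-^m,\mathrm{Id}],$$ $$E_3^m=[k^{m},k^m,k^{m+1};j_+^m,\mathrm{Id},j_-^m],\qquad E_4^m=[k^{m+1},k^{m+1},k^m;\pi_+^m,\mathrm{Id},\pi_-^m],$$ $$M=[0,k,0;0,0,0],\qquad M'=[k,0,k;\mathrm{Id},0,0].$$ Then an object of $Rep_k(Q_1)$ is exceptional if and only if it is isomorphic to one of $E_1^m,E_2^m,E_3^m,E_4^m$ ($m\geq 0$), $M$, $M'$. The dimensions $\hom(X,Y)$, $\hom^1(X,Y)$ for any pair of exceptional objects $X,Y$ are as follows: if $X\cong Y$, then $\hom(X,Y)=1$ and $\hom^1(X,Y)=0$; all other pairs are, up to isomorphism, contained in the table $$\begin{array}{| c | c | c | c | c | c | c |} \hline & & \hom & \hom^1 & & \hom & \hom^1 \\ \hline 0\leq m < n & (E_1^m,E_1^n) & 0 & n-m-1 & (E_1^n,E_1^m) & 1+n-m & 0 \\ \hline 0\leq n < m & (E_2^m,E_2^n)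 & 0 & m-n-1 & (E_2^n,E_2^m) & 1+m-n & 0 \\ \hline 0\leq n < m & (E_3^m,E_3^n) & 0 & m-n-1 & (E_3^n,E_3^m) & 1+m-n & 0 \\ \hline 0\leq m < n & (E_4^m,E_4^n) & 0 & n-m-1 & (E_4^n,E_4^m) & 1+n-m & 0 \\ \hline m\geq 0, n \geq 0 & (E_1^m,E_2^n) & 0 & n+m+2 & (E_2^n,E_1^m) & n+m & 0 \\ \hline m\geq 0, n \geq 0 & (E_1^m,E_3^n) & 0 & n+m+1 & (E_3^n,E_1^m) & n+m & 0 \\ \hline 0\leq m \leq n & (E_1^m,E_4^n) & 0 & n- m & (E_4^n,E_1^m) & 1+n-m & 0 \\ \hline 0\leq n < m & (E_1^m,E_4^n) & m-n & 0 & (E_4^n,E_1^m) & 0 & m-n-1 \\ \hline 0\leq n \leq m & (E_2^m,E_3^n) & 0 & m-n & (E_3^n,E_2^m) & 1+m-n & 0 \\ \hline 0\leq m <n & (E_2^m,E_3^n) & n-m & 0 & (E_3^n,E_2^m) & 0 & n-m-1 \\ \hline m \geq 0, n \geq 0 & (E_2^m,E_4^n) & 1+ n+m & 0 & (E_4^n,E_2^m)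 & 0 & n+m+2 \\ \hline m \geq 0, n \geq 0 & (E_3^m,E_4^n) & n+m & 0 & (E_4^n,E_3^m) & 0 & n+m+2 \\ \hline m \geq 0 & (M,E_1^m ) & 0 & 0 & (E_1^m,M) & 0 & 1 \\ \hline m \geq 0 & (M,E_2^m ) & 0 & 0 & (E_2^m,M) & 1 & 0 \\ \hline m \geq 0 & (M,E_3^m ) & 0 & 1 & (E_3^m,M) & 0 & 0 \\ \hline m \geq 0 & (M,E_4^m ) & 1 & 0 & (E_4^m,M) & 0 & 0 \\ \hline m \geq 0 & (M',E_1^m ) & 1 & 0 & (E_1^m,M') & 0 & 0 \\ \hline m \geq 0 & (M',E_2^m ) & 0 & 1 & (E_2^m,M') & 0 & 0 \\ \hline m \geq 0 & (M',E_3^m ) & 0 & 0 & (E_3^m,M') & 1 & 0 \\ \hline m \geq 0 & (M',E_4^m ) & 0 & 0 & (E_4^m,M') & 0 & 1 \\ \hline & (M,M' ) & 0 & 1 & (M',M) & 0 & 1 \\ \hline \end{array}$$ -/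

import Mathlib

open CategoryTheory

universe u

namespace ReprQ1

noncomputable section

/-- The vertices of the quiver `Q₁`. -/
inductive Vertex : Type
  | b
  | mid
  | e

/-- The arrows of `Q₁`: one arrow `b → e`, one arrow `b → mid` and one arrow `mid → e`. -/
inductive Arrow : Vertex → Vertex → Type
  | be : Arrow Vertex.b Vertex.e
  | bm : Arrow Vertex.b Vertex.mid
  | me : Arrow Vertex.mid Vertex.e

/-- The quiver `Q₁`: an acyclic orientation of the triangle. -/
instance : Quiver Vertex := ⟨Arrow⟩

/-- The category `Rep_k(Q₁)` of finite-dimensional `k`-representations of `Q₁`: functors from the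
free category on `Q₁` to finite-dimensional `k`-vector spaces. -/
abbrev Rep (k : Type u) [Field k] : Type (u + 1) :=
  Paths Vertex ⥤ FGModuleCat.{u} k

/-- Extension groups in `Rep_k(Q₁)` are available (a matter of universes only). -/
instance (k : Type u) [Field k] : HasExt.{u + 1} (Rep k) := HasExt.standard _

section General

variable (k : Type u) [Field k]

/-- An exceptional object: `Hom(X, X)` is one-dimensional and `Extⁱ(X, X) = 0` for all `i ≥ 1`. -/
def IsExceptional (X : Rep k) : Prop :=
  Module.rank k (X ⟶ X) = 1 ∧ ∀ i : ℕ, 1 ≤ i → Subsingleton (Abelian.Ext X X i)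

/-- `dim_k Hom(X, Y) = h` and `dim_k Ext¹(X, Y) = e`. The dimensions are cardinal-valued, so that
in particular both spaces are finite-dimensional. -/
def HasDims (X Y : Rep k) (h e : ℕ) : Prop :=
  Module.rank k (X ⟶ Y) = (h : Cardinal) ∧ Module.rank k (Abelian.Ext X Y 1) = (e : Cardinal)

/-- The representation with spaces `k^α`, `k^β`, `k^γ` at `b`, `mid`, `e` and linear maps
`f` on `b → e`, `g` on `b → mid`, `h` on `mid → e`. -/
def rep {α β γ : ℕ} (f : (Fin α → k) →ₗ[k] (Fin γ → k)) (g : (Fin α → k) →ₗ[k] (Fin β → k))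
    (h : (Fin β → k) →ₗ[k] (Fin γ → k)) : Rep k :=
  Paths.lift
    { obj := fun v => match v with
        | Vertex.b => FGModuleCat.of k (Fin α → k)
        | Vertex.mid => FGModuleCat.of k (Fin β → k)
        | Vertex.e => FGModuleCat.of k (Fin γ → k)
      map := fun a => match a with
        | Arrow.be => FGModuleCat.ofHom f
        | Arrow.bm => FGModuleCat.ofHom g
        | Arrow.me => FGModuleCat.ofHom h }

/-- `π₊(a₁, …, a_{m+1}) = (a₁, …, a_m)`. -/
def piPlus (m : ℕ) : (Fin (m + 1) → k) →ₗ[k] (Fin m → k) where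
  toFun a := fun i => a i.castSucc
  map_add' _ _ := rfl
  map_smul' _ _ := rfl

/-- `π₋(a₁, …, a_{m+1}) = (a₂, …, a_{m+1})`. -/
def piMinus (m : ℕ) : (Fin (m + 1) → k) →ₗ[k] (Fin m → k) where
  toFun a := fun i => a i.succ
  map_add' _ _ := rfl
  map_smul' _ _ := rfl

/-- `j₊(a₁, …, a_m) = (a₁, …, a_m, 0)`. -/
def jPlus (m : ℕ) : (Fin m → k) →ₗ[k] (Fin (m + 1) → k) where
  toFun a := Fin.snoc (α := fun _ => k) a 0
  map_add' x y := by
    funext i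
    refine Fin.lastCases ?_ (fun i => ?_) i <;> simp
  map_smul' c x := by
    funext i
    refine Fin.lastCases ?_ (fun i => ?_) i <;> simp

/-- `j₋(a₁, …, a_m) = (0, a₁, …, a_m)`. -/
def jMinus (m : ℕ) : (Fin m → k) →ₗ[k] (Fin (m + 1) → k) where
  toFun a := Fin.cons (α := fun _ => k) 0 a
  map_add' x y := by
    funext i
    refine Fin.cases ?_ (fun i => ?_) i <;> simp
  map_smul' c x := by
    funext i
    refine Fin.cases ?_ (fun i => ?_) i <;> simp

/-- Dimension vector `(m+1, m, m)`. -/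
def E1 (m : ℕ) : Rep k := rep k (piPlus k m) (piMinus k m) LinearMap.id

/-- Dimension vector `(m, m+1, m+1)`. -/
def E2 (m : ℕ) : Rep k := rep k (jPlus k m) (jMinus k m) LinearMap.id

/-- Dimension vector `(m, m, m+1)`. -/
def E3 (m : ℕ) : Rep k := rep k (jPlus k m) LinearMap.id (jMinus k m)

/-- Dimension vector `(m+1, m+1, m)`. -/
def E4 (m : ℕ) : Rep k := rep k (piPlus k m) LinearMap.id (piMinus k m)

/-- The simple representation at `mid`, with dimension vector `(0, 1, 0)`. -/
def M : Rep k := rep k (α := 0) (β := 1) (γ := 0) 0 0 0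

/-- Dimension vector `(1, 0, 1)`, with the identity on `b → e`. -/
def M' : Rep k := rep k (α := 1) (β := 0) (γ := 1) LinearMap.id 0 0

end General

end

end ReprQ1

namespace ReprQ1

noncomputable section

/-! ### Representations as triples of linear maps -/

section Representations

variable {k : Type u} [Field k]

/-! The path algebra is hereditary. Every representation `X` has the standard resolution `0 →
relations X → cover X → X → 0` by projectives, the middle term being indexed by vertices and the
left one by arrows. Hence `Ext` vanishes in degrees at least two, and `hom - hom¹` is the Euler form
of the dimension vectors (`finrank_ext_one_add`). Being exceptional therefore amounts to `hom = 1`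
and `hom¹ = 0`.

For the table, each listed pair has `hom = 0` or `hom¹ = 0`. The Euler form bounds `hom` from below
by the claimed value, so an upper bound on `hom` already gives both dimensions (`hasDims_rep`).
Upper bounds come from matrix entries. The commutation relations make the decisive component of a
morphism a banded Toeplitz matrix when both objects lie in `E1`, `E4` or both lie in `E2`, `E3`.
From `E2`, `E3` to `E1`, `E4` it is a Hankel matrix, and in the opposite direction it is zero. In
each case finitely many entries determine the morphism, and their number is the required bound.

For the classification, an exceptional object has a dimension vector on which the Euler form takes
the value 1. With successive differences `x`, `y` this reads `x² + xy + y² = 1`, which leaves six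
families (`dimension_cases`). Four of them are the dimension vectors of the `E` series. The other
two are `(m, m+1, m)` and `(m+1, m, m+1)`; for `m ≥ 1` a representation of such a dimension always
has a non-scalar endomorphism, and `m = 0` gives `M` and `M'`.

It remains to see that an exceptional object is determined by its dimension vector (`iso_of_rigid`).
This is the open orbit argument carried out on a line: if `Ext¹(X, X) = 0`, the identity of `X`
extends to a polynomial family of morphisms from `X` to the points of any line through `X`, and its
determinants vanish for only finitely many parameters. On the line joining two rigid representations
over an infinite field, some point is isomorphic to both. -/

abbrev pb : Paths Vertex := (Paths.of Vertex).obj Vertex.b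
abbrev pm : Paths Vertex := (Paths.of Vertex).obj Vertex.mid
abbrev pe : Paths Vertex := (Paths.of Vertex).obj Vertex.e

/-- The linear map on the arrow `b → e`. -/
def be (X : Rep k) : X.obj pb →ₗ[k] X.obj pe :=
  (X.map ((Paths.of Vertex).map Arrow.be)).hom.hom

/-- The linear map on the arrow `b → mid`. -/
def bm (X : Rep k) : X.obj pb →ₗ[k] X.obj pm :=
  (X.map ((Paths.of Vertex).map Arrow.bm)).hom.hom

/-- The linear map on the arrow `mid → e`. -/
def me (X : Rep k) : X.obj pm →ₗ[k] X.obj pe :=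
  (X.map ((Paths.of Vertex).map Arrow.me)).hom.hom

/-- The representation given by three linear maps. -/
def ofMaps {A B C : Type u} [AddCommGroup A] [Module k A] [Module.Finite k A]
    [AddCommGroup B] [Module k B] [Module.Finite k B]
    [AddCommGroup C] [Module k C] [Module.Finite k C]
    (f : A →ₗ[k] C) (g : A →ₗ[k] B) (h : B →ₗ[k] C) : Rep k :=
  Paths.lift
    { obj := fun v => match v with
        | Vertex.b => FGModuleCat.of k A
        | Vertex.mid => FGModuleCat.of k B
        | Vertex.e => FGModuleCat.of k C
      map := fun a => match a with
        | Arrow.be => FGModuleCat.ofHom f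
        | Arrow.bm => FGModuleCat.ofHom g
        | Arrow.me => FGModuleCat.ofHom h }

section OfMaps

variable {A B C : Type u} [AddCommGroup A] [Module k A] [Module.Finite k A]
    [AddCommGroup B] [Module k B] [Module.Finite k B]
    [AddCommGroup C] [Module k C] [Module.Finite k C]
    (f : A →ₗ[k] C) (g : A →ₗ[k] B) (h : B →ₗ[k] C)

theorem be_ofMaps : be (ofMaps f g h) = f := by
  simp only [be, ofMaps]
  erw [Paths.lift_toPath]
  rfl

theorem bm_ofMaps : bm (ofMaps f g h) = g := by
  simp only [bm, ofMaps]
  erw [Paths.lift_toPath]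
  rfl

theorem me_ofMaps : me (ofMaps f g h) = h := by
  simp only [me, ofMaps]
  erw [Paths.lift_toPath]
  rfl

end OfMaps

/-- The component of a morphism at a vertex. -/
def comp {X Y : Rep k} (φ : X ⟶ Y) (v : Paths Vertex) : X.obj v →ₗ[k] Y.obj v := (φ.app v).hom.hom

theorem comp_be {X Y : Rep k} (φ : X ⟶ Y) : be Y ∘ₗ comp φ pb = comp φ pe ∘ₗ be X :=
  congrArg (fun t => t.hom.hom) (φ.naturality ((Paths.of Vertex).map Arrow.be)).symm

theorem comp_bm {X Y : Rep k} (φ : X ⟶ Y) : bm Y ∘ₗ comp φ pb = comp φ pm ∘ₗ bm X :=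
  congrArg (fun t => t.hom.hom) (φ.naturality ((Paths.of Vertex).map Arrow.bm)).symm

theorem comp_me {X Y : Rep k} (φ : X ⟶ Y) : me Y ∘ₗ comp φ pm = comp φ pe ∘ₗ me X :=
  congrArg (fun t => t.hom.hom) (φ.naturality ((Paths.of Vertex).map Arrow.me)).symm

theorem rep_hom_ext {X Y : Rep k} {φ ψ : X ⟶ Y} (hb : comp φ pb = comp ψ pb)
    (hm : comp φ pm = comp ψ pm) (he : comp φ pe = comp ψ pe) : φ = ψ := by
  apply NatTrans.ext
  funext v
  apply FGModuleCat.hom_ext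
  cases v
  exacts [hb, hm, he]

/-- The components of a morphism given by three linear maps. -/
def homMkApp {X Y : Rep k} (a : X.obj pb →ₗ[k] Y.obj pb) (b : X.obj pm →ₗ[k] Y.obj pm)
    (c : X.obj pe →ₗ[k] Y.obj pe) : ∀ v : Paths Vertex, X.obj v ⟶ Y.obj v
  | Vertex.b => FGModuleCat.ofHom a
  | Vertex.mid => FGModuleCat.ofHom b
  | Vertex.e => FGModuleCat.ofHom c

/-- Morphisms from triples of linear maps. -/
def homMk {X Y : Rep k} (a : X.obj pb →ₗ[k] Y.obj pb) (b : X.obj pm →ₗ[k] Y.obj pm)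
    (c : X.obj pe →ₗ[k] Y.obj pe) (hbe : be Y ∘ₗ a = c ∘ₗ be X) (hbm : bm Y ∘ₗ a = b ∘ₗ bm X)
    (hme : me Y ∘ₗ b = c ∘ₗ me X) : X ⟶ Y where
  app := homMkApp a b c
  naturality {v w} p := by
    have key : ∀ {w x : Vertex} (q : Arrow w x),
        X.map ((Paths.of Vertex).map q) ≫ homMkApp a b c x =
          homMkApp a b c w ≫ Y.map ((Paths.of Vertex).map q) := by
      intro w x q
      cases q
      · exact FGModuleCat.hom_ext hbe.symm
      · exact FGModuleCat.hom_ext hbm.symm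
      · exact FGModuleCat.hom_ext hme.symm
    refine Paths.induction
      (fun {v w} p => X.map p ≫ homMkApp a b c w = homMkApp a b c v ≫ Y.map p) ?_ ?_ p
    · intro v
      rw [X.map_id, Y.map_id, Category.id_comp, Category.comp_id]
    · intro v w x p q hp
      rw [X.map_comp, Y.map_comp, Category.assoc, ← reassoc_of% hp]
      exact congrArg _ (key q)

section HomMk

variable {X Y : Rep k} (a : X.obj pb →ₗ[k] Y.obj pb) (b : X.obj pm →ₗ[k] Y.obj pm)
    (c : X.obj pe →ₗ[k] Y.obj pe) (hbe : be Y ∘ₗ a = c ∘ₗ be X) (hbm : bm Y ∘ₗ a = b ∘ₗ bm X)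
    (hme : me Y ∘ₗ b = c ∘ₗ me X)

@[simp] theorem comp_homMk_b : comp (homMk a b c hbe hbm hme) pb = a := rfl
@[simp] theorem comp_homMk_m : comp (homMk a b c hbe hbm hme) pm = b := rfl
@[simp] theorem comp_homMk_e : comp (homMk a b c hbe hbm hme) pe = c := rfl

end HomMk

@[simp] theorem comp_comp {X Y Z : Rep k} (φ : X ⟶ Y) (ψ : Y ⟶ Z) (v : Paths Vertex) :
    comp (φ ≫ ψ) v = comp ψ v ∘ₗ comp φ v := rfl

@[simp] theorem comp_id (X : Rep k) (v : Paths Vertex) : comp (𝟙 X) v = LinearMap.id := rfl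

@[simp] theorem comp_zero (X Y : Rep k) (v : Paths Vertex) : comp (0 : X ⟶ Y) v = 0 := rfl

@[simp] theorem comp_add {X Y : Rep k} (φ ψ : X ⟶ Y) (v : Paths Vertex) :
    comp (φ + ψ) v = comp φ v + comp ψ v := rfl

@[simp] theorem comp_smul {X Y : Rep k} (t : k) (φ : X ⟶ Y) (v : Paths Vertex) :
    comp (t • φ) v = t • comp φ v := rfl

/-- The triples of linear maps commuting with the structure maps of two representations. -/
def homSub {A B C A' B' C' : Type*} [AddCommGroup A] [Module k A] [AddCommGroup B] [Module k B]
    [AddCommGroup C] [Module k C] [AddCommGroup A'] [Module k A'] [AddCommGroup B'] [Module k B']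
    [AddCommGroup C'] [Module k C']
    (f : A →ₗ[k] C) (g : A →ₗ[k] B) (h : B →ₗ[k] C)
    (f' : A' →ₗ[k] C') (g' : A' →ₗ[k] B') (h' : B' →ₗ[k] C') :
    Submodule k ((A →ₗ[k] A') × (B →ₗ[k] B') × (C →ₗ[k] C')) where
  carrier := {x | f' ∘ₗ x.1 = x.2.2 ∘ₗ f ∧ g' ∘ₗ x.1 = x.2.1 ∘ₗ g ∧ h' ∘ₗ x.2.1 = x.2.2 ∘ₗ h}
  add_mem' := by
    rintro x y ⟨h1, h2, h3⟩ ⟨h4, h5, h6⟩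
    simp [LinearMap.comp_add, LinearMap.add_comp, *]
  zero_mem' := by simp
  smul_mem' := by
    rintro c x ⟨h1, h2, h3⟩
    simp [LinearMap.comp_smul, LinearMap.smul_comp, *]

/-- Morphisms of representations are commuting triples of linear maps. -/
def homLinearEquiv (X Y : Rep k) :
    (X ⟶ Y) ≃ₗ[k] homSub (be X) (bm X) (me X) (be Y) (bm Y) (me Y) where
  toFun φ := ⟨(comp φ pb, comp φ pm, comp φ pe), comp_be φ, comp_bm φ, comp_me φ⟩
  map_add' _ _ := rfl
  map_smul' _ _ := rfl
  invFun x := homMk x.1.1 x.1.2.1 x.1.2.2 x.2.1 x.2.2.1 x.2.2.2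
  left_inv _ := rep_hom_ext rfl rfl rfl
  right_inv _ := rfl

/-- An isomorphism of representations from linear equivalences. -/
def isoMk {X Y : Rep k} (a : X.obj pb ≃ₗ[k] Y.obj pb) (b : X.obj pm ≃ₗ[k] Y.obj pm)
    (c : X.obj pe ≃ₗ[k] Y.obj pe) (hbe : be Y ∘ₗ a.toLinearMap = c.toLinearMap ∘ₗ be X)
    (hbm : bm Y ∘ₗ a.toLinearMap = b.toLinearMap ∘ₗ bm X)
    (hme : me Y ∘ₗ b.toLinearMap = c.toLinearMap ∘ₗ me X) : X ≅ Y where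
  hom := homMk a.toLinearMap b.toLinearMap c.toLinearMap hbe hbm hme
  inv := homMk a.symm.toLinearMap b.symm.toLinearMap c.symm.toLinearMap
    (by ext x; apply c.injective; simpa using (LinearMap.congr_fun hbe (a.symm x)).symm)
    (by ext x; apply b.injective; simpa using (LinearMap.congr_fun hbm (a.symm x)).symm)
    (by ext x; apply c.injective; simpa using (LinearMap.congr_fun hme (b.symm x)).symm)
  hom_inv_id := by apply rep_hom_ext <;> ext x <;> simp
  inv_hom_id := by apply rep_hom_ext <;> ext x <;> simp

/-- An epimorphism cannot distinguish the quotient map by its range from zero, so that quotient is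
trivial. -/
theorem epi_surjective {V W : FGModuleCat.{u} k} (φ : V ⟶ W) [Epi φ] :
    Function.Surjective φ.hom.hom := by
  rw [← LinearMap.range_eq_top, ← Submodule.ker_mkQ (LinearMap.range φ.hom.hom),
    LinearMap.ker_eq_top]
  let q : W ⟶ FGModuleCat.of k (W ⧸ LinearMap.range φ.hom.hom) :=
    FGModuleCat.ofHom (LinearMap.range φ.hom.hom).mkQ
  have h : φ ≫ q = φ ≫ 0 := by
    apply FGModuleCat.hom_ext
    exact LinearMap.range_mkQ_comp _
  exact congrArg (fun t => t.hom.hom) ((cancel_epi φ).1 h)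

theorem surjective_comp_of_epi {X Y : Rep k} (φ : X ⟶ Y) [Epi φ] (v : Paths Vertex) :
    Function.Surjective (comp φ v) :=
  epi_surjective (φ.app v)

theorem epi_of_surjective {X Y : Rep k} (φ : X ⟶ Y)
    (hb : Function.Surjective (comp φ pb)) (hm : Function.Surjective (comp φ pm))
    (he : Function.Surjective (comp φ pe)) : Epi φ := by
  constructor
  intro Z α β h
  have key (v) (hv : Function.Surjective (comp φ v)) : comp α v = comp β v :=
    (LinearMap.cancel_right hv).1 (congrArg (fun t => comp t v) h)
  exact rep_hom_ext (key _ hb) (key _ hm) (key _ he)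

theorem mono_of_injective {X Y : Rep k} (φ : X ⟶ Y)
    (hb : Function.Injective (comp φ pb)) (hm : Function.Injective (comp φ pm))
    (he : Function.Injective (comp φ pe)) : Mono φ := by
  constructor
  intro Z α β h
  have key (v) (hv : Function.Injective (comp φ v)) : comp α v = comp β v :=
    (LinearMap.cancel_left hv).1 (congrArg (fun t => comp t v) h)
  exact rep_hom_ext (key _ hb) (key _ hm) (key _ he)

end Representations

/-! ### Extensions computed from a projective presentation -/

section ShortExact

open Abelian

variable (k : Type*) [Field k] {C : Type*} [Category* C] [Abelian C] [Linear k C]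
  {S : ShortComplex C} (Y : C)

/-- Precomposition as a linear map. -/
def precomp {X₁ X₂ : C} (f : X₁ ⟶ X₂) : (X₂ ⟶ Y) →ₗ[k] (X₁ ⟶ Y) where
  toFun φ := f ≫ φ
  map_add' := by simp
  map_smul' := by simp

theorem ker_precomp (hS : S.ShortExact) :
    LinearMap.ker (precomp k Y S.f) = LinearMap.range (precomp k Y S.g) := by
  have := hS.epi_g
  ext φ
  rw [LinearMap.mem_ker, LinearMap.mem_range]
  exact ⟨fun h => ⟨hS.exact.desc φ h, hS.exact.g_desc φ h⟩, by
    rintro ⟨ψ, rfl⟩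
    simp [precomp]⟩

theorem precomp_injective (hS : S.ShortExact) : Function.Injective (precomp k Y S.g) := by
  have := hS.epi_g
  exact fun φ ψ h => (cancel_epi S.g).1 h

section Extensions

variable [HasExt.{u} C]

/-- The connecting map from morphisms to extensions. -/
def connecting (hS : S.ShortExact) : (S.X₁ ⟶ Y) →ₗ[k] Ext S.X₃ Y 1 :=
  (Ext.precompOfLinear hS.extClass k Y (add_zero 1)) ∘ₗ
    (Ext.linearEquiv₀ (R := k)).symm.toLinearMap

theorem connecting_apply (hS : S.ShortExact) (φ : S.X₁ ⟶ Y) :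
    connecting k Y hS φ = hS.extClass.comp (Ext.mk₀ φ) (add_zero 1) := rfl

theorem connecting_surjective (hS : S.ShortExact)
    [Projective S.X₂] :
    Function.Surjective (connecting k Y hS) := by
  intro γ
  obtain ⟨x, hx⟩ := Ext.contravariant_sequence_exact₃ hS Y γ
      (Ext.eq_zero_of_projective _) (n₀ := 0) rfl
  refine ⟨Ext.linearEquiv₀ (R := k) x, ?_⟩
  rw [connecting_apply, Ext.mk₀_linearEquiv₀_apply, hx]

theorem ker_connecting (hS : S.ShortExact) :
    LinearMap.ker (connecting k Y hS) = LinearMap.range (precomp k Y S.f) := by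
  ext φ
  rw [LinearMap.mem_ker, connecting_apply, LinearMap.mem_range]
  constructor
  · intro h
    obtain ⟨x, hx⟩ := Ext.contravariant_sequence_exact₁ hS Y _ _ h
    obtain ⟨ψ, rfl⟩ := (Ext.mk₀_bijective _ _).2 x
    rw [Ext.mk₀_comp_mk₀] at hx
    exact ⟨ψ, (Ext.mk₀_bijective _ _).1 hx⟩
  · rintro ⟨ψ, rfl⟩
    change hS.extClass.comp (Ext.mk₀ (S.f ≫ ψ)) _ = 0
    rw [← Ext.mk₀_comp_mk₀]
    exact hS.extClass_comp_assoc _ (h := rfl)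

theorem finite_ext_one_of_projective (hS : S.ShortExact)
    [Projective S.X₂] [Module.Finite k (S.X₁ ⟶ Y)] :
    Module.Finite k (Ext S.X₃ Y 1) :=
  Module.Finite.of_surjective _ (connecting_surjective k Y hS)

/-- Alternating sum of dimensions along `0 → Hom(X₃, Y) → Hom(X₂, Y) → Hom(X₁, Y) → Ext¹(X₃, Y) →
0`, which ends there because `X₂` is projective. -/
theorem finrank_ext_one_of_projective (hS : S.ShortExact)
    [Projective S.X₂] [Module.Finite k (S.X₁ ⟶ Y)]
    [Module.Finite k (S.X₂ ⟶ Y)] :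
    Module.finrank k (Ext S.X₃ Y 1) + Module.finrank k (S.X₂ ⟶ Y) =
      Module.finrank k (S.X₁ ⟶ Y) + Module.finrank k (S.X₃ ⟶ Y) := by
  have h1 := LinearMap.finrank_range_add_finrank_ker (connecting k Y hS)
  have h2 := LinearMap.finrank_range_add_finrank_ker (precomp k Y S.f)
  rw [LinearMap.range_eq_top.2 (connecting_surjective k Y hS), finrank_top, ker_connecting] at h1
  rw [ker_precomp k Y hS, LinearMap.finrank_range_of_inj (precomp_injective k Y hS)] at h2
  omega

/-- In the long exact sequence this group sits between `Ext` of `X₁` in degree `n + 1` and `Ext` of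
`X₂` in degree `n + 2`, both zero. -/
theorem subsingleton_ext_of_projective (hS : S.ShortExact)
    [Projective S.X₁] [Projective S.X₂] (n : ℕ) :
    Subsingleton (Ext S.X₃ Y (n + 2)) := by
  refine subsingleton_of_forall_eq 0 fun γ => ?_
  obtain ⟨x, rfl⟩ := Ext.contravariant_sequence_exact₃ hS Y γ
    (Ext.eq_zero_of_projective _) (n₀ := n + 1) (by omega)
  rw [Ext.eq_zero_of_projective x, Ext.comp_zero]

end Extensions

end ShortExact

section HomOfMaps

variable {k : Type u} [Field k]
variable {A B C : Type u} [AddCommGroup A] [Module k A] [Module.Finite k A]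
    [AddCommGroup B] [Module k B] [Module.Finite k B]
    [AddCommGroup C] [Module k C] [Module.Finite k C]
    {f : A →ₗ[k] C} {g : A →ₗ[k] B} {h : B →ₗ[k] C}
variable {A' B' C' : Type u} [AddCommGroup A'] [Module k A'] [Module.Finite k A']
    [AddCommGroup B'] [Module k B'] [Module.Finite k B']
    [AddCommGroup C'] [Module k C'] [Module.Finite k C']
    {f' : A' →ₗ[k] C'} {g' : A' →ₗ[k] B'} {h' : B' →ₗ[k] C'}

/-- A morphism to an explicit representation. -/
def toOfMaps {T : Rep k} (a : T.obj pb →ₗ[k] A) (b : T.obj pm →ₗ[k] B) (c : T.obj pe →ₗ[k] C)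
    (hbe : f ∘ₗ a = c ∘ₗ be T) (hbm : g ∘ₗ a = b ∘ₗ bm T) (hme : h ∘ₗ b = c ∘ₗ me T) :
    T ⟶ ofMaps f g h :=
  homMk (Y := ofMaps f g h) a b c (by rw [be_ofMaps]; exact hbe) (by rw [bm_ofMaps]; exact hbm)
    (by rw [me_ofMaps]; exact hme)

/-- A morphism from an explicit representation. -/
def fromOfMaps {T : Rep k} (a : A →ₗ[k] T.obj pb) (b : B →ₗ[k] T.obj pm) (c : C →ₗ[k] T.obj pe)
    (hbe : be T ∘ₗ a = c ∘ₗ f) (hbm : bm T ∘ₗ a = b ∘ₗ g) (hme : me T ∘ₗ b = c ∘ₗ h) :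
    ofMaps f g h ⟶ T :=
  homMk (X := ofMaps f g h) a b c (by rw [be_ofMaps]; exact hbe) (by rw [bm_ofMaps]; exact hbm)
    (by rw [me_ofMaps]; exact hme)

/-- A morphism between explicit representations. -/
def mapOfMaps (a : A →ₗ[k] A') (b : B →ₗ[k] B') (c : C →ₗ[k] C')
    (hbe : f' ∘ₗ a = c ∘ₗ f) (hbm : g' ∘ₗ a = b ∘ₗ g) (hme : h' ∘ₗ b = c ∘ₗ h) :
    ofMaps f g h ⟶ ofMaps f' g' h' :=
  toOfMaps (T := ofMaps f g h) a b c (by rw [be_ofMaps]; exact hbe) (by rw [bm_ofMaps]; exact hbm)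
    (by rw [me_ofMaps]; exact hme)

end HomOfMaps

/-! ### Free representations and their projectivity -/

section Free

variable {k : Type u} [Field k]
variable (A B C : Type u) [AddCommGroup A] [Module k A] [Module.Finite k A]
    [AddCommGroup B] [Module k B] [Module.Finite k B]
    [AddCommGroup C] [Module k C] [Module.Finite k C]

/-- The representation freely generated by `A` at `b`, `B` at `mid` and `C` at `e`. -/
def free : Rep k :=
  -- There are two paths from `b` to `e`, hence two copies of `A` at `e`: the first for the direct
  -- arrow, the second for the path through `mid`.
  ofMaps (A := A) (B := A × B) (C := (A × A) × (B × C))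
    (LinearMap.inl k _ _ ∘ₗ LinearMap.inl k A A) (LinearMap.inl k A B)
    ((LinearMap.inr k A A).prodMap (LinearMap.inl k B C))

theorem be_free : be (free (k := k) A B C) = LinearMap.inl k _ _ ∘ₗ LinearMap.inl k A A :=
  be_ofMaps _ _ _

theorem bm_free : bm (free (k := k) A B C) = LinearMap.inl k A B :=
  bm_ofMaps _ _ _

theorem me_free : me (free (k := k) A B C) =
    (LinearMap.inr k A A).prodMap (LinearMap.inl k B C) :=
  me_ofMaps _ _ _

variable {A B C}

/-- The morphism out of `free A B C` determined by the images of the generators. -/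
def freeDesc (Y : Rep k) (p : A →ₗ[k] Y.obj pb) (q : B →ₗ[k] Y.obj pm) (r : C →ₗ[k] Y.obj pe) :
    free A B C ⟶ Y :=
  fromOfMaps p ((bm Y ∘ₗ p).coprod q)
    (((be Y ∘ₗ p).coprod (me Y ∘ₗ bm Y ∘ₗ p)).coprod ((me Y ∘ₗ q).coprod r))
    (by ext x; simp) (by ext x; simp) (by refine LinearMap.prod_ext ?_ ?_ <;> ext x <;> simp)

/-- Morphisms out of `free A B C` are determined by the images of the generators. -/
def freeEquiv (Y : Rep k) : (free A B C ⟶ Y) ≃ₗ[k]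
    (A →ₗ[k] Y.obj pb) × (B →ₗ[k] Y.obj pm) × (C →ₗ[k] Y.obj pe) where
  toFun φ := (comp φ pb, comp φ pm ∘ₗ LinearMap.inr k A B,
    comp φ pe ∘ₗ LinearMap.inr k (A × A) (B × C) ∘ₗ LinearMap.inr k B C)
  map_add' _ _ := rfl
  map_smul' _ _ := rfl
  invFun x := freeDesc Y x.1 x.2.1 x.2.2
  left_inv φ := by
    have h1 := comp_be φ
    have h2 := comp_bm φ
    have h3 := comp_me φ
    rw [be_free] at h1
    rw [bm_free] at h2
    rw [me_free] at h3
    have h3' (x : A × B) : me Y (comp φ pm x) = comp φ pe ((0, x.1), (x.2, 0)) :=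
      LinearMap.congr_fun h3 x
    have h2' (x : A) : bm Y (comp φ pb x) = comp φ pm (x, 0) := LinearMap.congr_fun h2 x
    have h1' (x : A) : be Y (comp φ pb x) = comp φ pe ((x, 0), 0) := LinearMap.congr_fun h1 x
    refine rep_hom_ext rfl ?_ ?_
    · refine LinearMap.prod_ext (M := A) (M₂ := B) ?_ ?_
      · ext x
        exact (LinearMap.congr_fun (LinearMap.coprod_inl _ _) x).trans (h2' x)
      · exact LinearMap.coprod_inr _ _
    · refine LinearMap.prod_ext (M := A × A) (M₂ := B × C) ?_ ?_
      · refine (LinearMap.coprod_inl _ _).trans ?_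
        refine LinearMap.prod_ext ?_ ?_
        · ext x
          exact (LinearMap.congr_fun (LinearMap.coprod_inl _ _) x).trans (h1' x)
        · ext x
          refine (LinearMap.congr_fun (LinearMap.coprod_inr _ _) x).trans ?_
          exact (congrArg _ (h2' x)).trans (h3' (x, 0))
      · refine (LinearMap.coprod_inr _ _).trans ?_
        refine LinearMap.prod_ext ?_ ?_
        · ext x
          exact (LinearMap.congr_fun (LinearMap.coprod_inl _ _) x).trans (h3' (0, x))
        · exact LinearMap.coprod_inr _ _
  right_inv x := by
    refine Prod.ext rfl (Prod.ext ?_ ?_)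
    · exact LinearMap.coprod_inr _ _
    · exact (congrArg (· ∘ₗ LinearMap.inr k B C) (LinearMap.coprod_inr _ _)).trans
        (LinearMap.coprod_inr _ _)

instance : Projective (free (k := k) A B C) where
  factors {E X} f e he := by
    have lift {V : Type u} [AddCommGroup V] [Module k V] (v : Paths Vertex)
        (p : V →ₗ[k] X.obj v) : ∃ q : V →ₗ[k] E.obj v, comp e v ∘ₗ q = p :=
      Module.projective_lifting_property _ _ (surjective_comp_of_epi e v)
    obtain ⟨p, hp⟩ := lift pb (freeEquiv X f).1
    obtain ⟨q, hq⟩ := lift pm (freeEquiv X f).2.1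
    obtain ⟨r, hr⟩ := lift pe (freeEquiv X f).2.2
    refine ⟨freeDesc E p q r, (freeEquiv X).injective ?_⟩
    have h := (freeEquiv E).right_inv (p, q, r)
    have h1 : comp (freeDesc E p q r) pm ∘ₗ LinearMap.inr k A B = q :=
      congrArg (fun t => t.2.1) h
    have h2 : comp (freeDesc E p q r) pe ∘ₗ LinearMap.inr k (A × A) (B × C) ∘ₗ
      LinearMap.inr k B C = r := congrArg (fun t => t.2.2) h
    refine Prod.ext hp (Prod.ext ?_ ?_)
    · exact (congrArg (comp e pm ∘ₗ ·) h1).trans hq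
    · exact (congrArg (comp e pe ∘ₗ ·) h2).trans hr

end Free

/-! ### The standard projective resolution -/

section Resolution

variable {k : Type u} [Field k] (X : Rep k)

/-- The canonical free cover of a representation. -/
abbrev cover : Rep k := free (X.obj pb) (X.obj pm) (X.obj pe)

/-- The kernel of the canonical free cover. -/
abbrev relations : Rep k := free PUnit.{u + 1} (X.obj pb) (X.obj pb × X.obj pm)

/-- The component at `mid` of the projection of the canonical free cover. -/
def coverπm : (X.obj pb × X.obj pm) →ₗ[k] X.obj pm := (bm X).coprod LinearMap.id

/-- The component at `e` of the projection of the canonical free cover. -/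
def coverπe : ((X.obj pb × X.obj pb) × (X.obj pm × X.obj pe)) →ₗ[k] X.obj pe :=
  ((be X).coprod (me X ∘ₗ bm X)).coprod ((me X).coprod LinearMap.id)

/-- The projection of the canonical free cover. -/
def coverπ : cover X ⟶ X :=
  fromOfMaps LinearMap.id (coverπm X) (coverπe X)
    (by ext x; simp [coverπe]) (by ext x; simp [coverπm])
    (by refine LinearMap.prod_ext ?_ ?_ <;> ext x <;> simp [coverπm, coverπe])

/-- The component at `mid` of the inclusion of the relations. -/
def coverιm : (PUnit.{u + 1} × X.obj pb) →ₗ[k] (X.obj pb × X.obj pm) :=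
  (LinearMap.id.prod (-bm X)) ∘ₗ LinearMap.snd k _ _

/-- The component at `e` of the inclusion of the relations. -/
def coverιe : ((PUnit.{u + 1} × PUnit.{u + 1}) × (X.obj pb × (X.obj pb × X.obj pm))) →ₗ[k]
    ((X.obj pb × X.obj pb) × (X.obj pm × X.obj pe)) where
  -- The three coordinates beyond the trivial one belong to the arrows `b → mid`, `b → e`, `mid →
  -- e`, in this order. Each is sent to the difference between following its arrow formally in the
  -- free cover and applying the arrow in `X`.
  toFun x := ((x.2.2.1, x.2.1), (x.2.2.2 - bm X x.2.1, - be X x.2.2.1 - me X x.2.2.2))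
  map_add' x y := by
    ext <;> simp <;> abel
  map_smul' c x := by
    ext <;> simp [smul_sub]

theorem coverιm_apply (x) : coverιm X x = (x.2, -bm X x.2) := rfl

theorem coverιe_apply (x) : coverιe X x =
    ((x.2.2.1, x.2.1), (x.2.2.2 - bm X x.2.1, - be X x.2.2.1 - me X x.2.2.2)) := rfl

/-- The inclusion of the relations into the canonical free cover. -/
def coverι : relations X ⟶ cover X :=
  mapOfMaps 0 (coverιm X) (coverιe X)
    (by refine LinearMap.ext fun x => ?_; rw [Subsingleton.elim x 0, map_zero, map_zero])
    (by refine LinearMap.ext fun x => ?_; rw [Subsingleton.elim x 0, map_zero, map_zero])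
    (by refine LinearMap.ext fun x => ?_; simp [coverιm_apply, coverιe_apply])

theorem coverι_comp_coverπ : coverι X ≫ coverπ X = 0 := by
  apply rep_hom_ext
  · rfl
  · have : coverπm X ∘ₗ coverιm X = 0 := by
      refine LinearMap.ext fun x => ?_; simp [coverιm_apply, coverπm]
    exact this
  · have : coverπe X ∘ₗ coverιe X = 0 := by
      refine LinearMap.ext fun x => ?_; simp [coverιe_apply, coverπe]
    exact this

instance : Epi (coverπ X) := by
  apply epi_of_surjective
  · exact fun x => ⟨x, rfl⟩
  · have : Function.Surjective (coverπm X) := fun x => ⟨(0, x), by simp [coverπm]⟩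
    exact this
  · have : Function.Surjective (coverπe X) := fun x => ⟨(0, (0, x)), by simp [coverπe]⟩
    exact this

instance : Mono (coverι X) := by
  apply mono_of_injective
  · intro x y _
    exact Subsingleton.elim (α := PUnit.{u + 1}) x y
  · have : Function.Injective (coverιm X) := by
      intro x y h
      exact Prod.ext rfl (congrArg Prod.fst h)
    exact this
  · have : Function.Injective (coverιe X) := by
      rintro ⟨x1, x2, x3, x4⟩ ⟨y1, y2, y3, y4⟩ h
      simp only [coverιe_apply, Prod.mk.injEq] at h
      obtain ⟨⟨rfl, rfl⟩, h3, -⟩ := h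
      rw [sub_left_injective h3, Subsingleton.elim x1 y1]
    exact this

/-- The component at `e` of the factorization through `coverι X`. -/
def coverLifte : ((X.obj pb × X.obj pb) × (X.obj pm × X.obj pe)) →ₗ[k]
    ((PUnit.{u + 1} × PUnit.{u + 1}) × (X.obj pb × (X.obj pb × X.obj pm))) where
  toFun x := ((0, 0), (x.1.2, (x.1.1, x.2.1 + bm X x.1.2)))
  map_add' x y := by
    ext <;> simp; abel
  map_smul' c x := by
    ext <;> simp

/-- Exactness in the middle. An element of the kernel is zero at `b`, at `mid` it is determined by
its `X_b` coordinate, and at `e` its `X_e` coordinate is determined by the others; the lift reads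
off these free coordinates. -/
theorem exists_coverLift {T : Rep k} (φ : T ⟶ cover X) (hφ : φ ≫ coverπ X = 0) :
    ∃ ψ : T ⟶ relations X, ψ ≫ coverι X = φ := by
  have ha : comp φ pb = 0 := congrArg (fun t => comp t pb) hφ
  obtain ⟨b, hb⟩ : ∃ b : T.obj pm →ₗ[k] (X.obj pb × X.obj pm), b = comp φ pm := ⟨_, rfl⟩
  obtain ⟨c, hc⟩ : ∃ c : T.obj pe →ₗ[k] ((X.obj pb × X.obj pb) × (X.obj pm × X.obj pe)),
    c = comp φ pe := ⟨_, rfl⟩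
  have hπb : coverπm X ∘ₗ b = 0 := by rw [hb]; exact congrArg (fun t => comp t pm) hφ
  have hπc : coverπe X ∘ₗ c = 0 := by rw [hc]; exact congrArg (fun t => comp t pe) hφ
  have h1 : c ∘ₗ be T = 0 := by
    rw [hc]; refine (comp_be φ).symm.trans ?_; rw [ha]; exact LinearMap.comp_zero _
  have h2 : b ∘ₗ bm T = 0 := by
    rw [hb]; refine (comp_bm φ).symm.trans ?_; rw [ha]; exact LinearMap.comp_zero _
  have h3 : (LinearMap.inr k (X.obj pb) (X.obj pb)).prodMap
      (LinearMap.inl k (X.obj pm) (X.obj pe)) ∘ₗ b = c ∘ₗ me T := by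
    rw [hb, hc]; refine Eq.trans ?_ (comp_me φ); rw [me_free]; rfl
  refine ⟨toOfMaps 0 ((0 : _ →ₗ[k] PUnit.{u + 1}).prod (LinearMap.fst k _ _ ∘ₗ b))
    (coverLifte X ∘ₗ c) ?_ ?_ ?_, ?_⟩
  · rw [LinearMap.comp_zero]
    exact ((congrArg (coverLifte X ∘ₗ ·) h1).trans (LinearMap.comp_zero _)).symm
  · rw [LinearMap.comp_zero]
    refine LinearMap.ext fun x => ?_
    have := LinearMap.congr_fun h2 x
    simp only [LinearMap.comp_apply, LinearMap.zero_apply] at this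
    simp [this]
    rfl
  · refine Eq.trans ?_ (congrArg (coverLifte X ∘ₗ ·) h3)
    refine LinearMap.ext fun x => ?_
    have := LinearMap.congr_fun hπb x
    simp [coverπm] at this
    have h : (b x).2 + bm X (b x).1 = 0 := by rw [add_comm, this]
    simp [coverLifte, h]
    rfl
  · refine rep_hom_ext ha.symm ?_ ?_
    · refine Eq.trans ?_ hb
      have : coverιm X ∘ₗ ((0 : _ →ₗ[k] PUnit.{u + 1}).prod (LinearMap.fst k _ _ ∘ₗ b)) = b := by
        refine LinearMap.ext fun x => ?_
        have := LinearMap.congr_fun hπb x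
        simp [coverπm] at this
        ext
        · rfl
        · simp [coverιm_apply]
          exact neg_eq_of_add_eq_zero_right this
      exact this
    · refine Eq.trans ?_ hc
      have : coverιe X ∘ₗ coverLifte X ∘ₗ c = c := by
        refine LinearMap.ext fun x => ?_
        have := LinearMap.congr_fun hπc x
        simp [coverπe] at this
        ext <;> simp [coverιe_apply, coverLifte]
        rw [← sub_eq_zero, ← neg_eq_zero, ← this]
        abel
      exact this

/-- The canonical projective resolution. -/
def resolution : ShortComplex (Rep k) :=
  ShortComplex.mk (coverι X) (coverπ X) (coverι_comp_coverπ X)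

theorem resolution_shortExact : (resolution X).ShortExact :=
  have : Mono (resolution X).f := inferInstanceAs (Mono (coverι X))
  { exact := ShortComplex.exact_of_f_is_kernel _ <|
      Limits.KernelFork.IsLimit.ofι' _ _ fun φ hφ =>
        ⟨(exists_coverLift X φ hφ).choose, (exists_coverLift X φ hφ).choose_spec⟩
    mono_f := this
    epi_g := inferInstanceAs (Epi (coverπ X)) }

end Resolution

/-! ### The Euler form -/

section Dimensions

variable {k : Type u} [Field k]

instance (X Y : Rep k) : Module.Finite k (X ⟶ Y) :=
  Module.Finite.equiv (homLinearEquiv X Y).symm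

theorem finrank_free_hom {A B C : Type u} [AddCommGroup A] [Module k A] [Module.Finite k A]
    [AddCommGroup B] [Module k B] [Module.Finite k B]
    [AddCommGroup C] [Module k C] [Module.Finite k C] (Y : Rep k) :
    Module.finrank k (free (k := k) A B C ⟶ Y) =
      Module.finrank k A * Module.finrank k (Y.obj pb) +
      (Module.finrank k B * Module.finrank k (Y.obj pm) +
       Module.finrank k C * Module.finrank k (Y.obj pe)) := by
  rw [(freeEquiv Y).finrank_eq, Module.finrank_prod, Module.finrank_prod,
    Module.finrank_linearMap, Module.finrank_linearMap, Module.finrank_linearMap]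

open Abelian in
theorem subsingleton_ext (X Y : Rep k) (n : ℕ) : Subsingleton (Ext X Y (n + 2)) :=
  have : Projective (resolution X).X₁ := inferInstanceAs (Projective (relations X))
  have : Projective (resolution X).X₂ := inferInstanceAs (Projective (cover X))
  subsingleton_ext_of_projective Y (resolution_shortExact X) n

open Abelian in
-- Needed to pass from `finrank` to the cardinal rank in `HasDims`, since `finrank` is zero by
-- default on infinite-dimensional spaces.
theorem finite_ext_one (X Y : Rep k) : Module.Finite k (Ext X Y 1) :=
  have : Projective (resolution X).X₂ := inferInstanceAs (Projective (cover X))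
  have : Module.Finite k ((resolution X).X₁ ⟶ Y) :=
    inferInstanceAs (Module.Finite k (relations X ⟶ Y))
  finite_ext_one_of_projective k Y (resolution_shortExact X)

open Abelian in
-- The Euler form, with terms moved so that no subtraction occurs in `ℕ`. Morphisms from the cover
-- contribute one product per vertex, morphisms from the relations one product per arrow.
theorem finrank_ext_one_add (X Y : Rep k) :
    Module.finrank k (Ext X Y 1) +
      (Module.finrank k (X.obj pb) * Module.finrank k (Y.obj pb) +
      Module.finrank k (X.obj pm) * Module.finrank k (Y.obj pm) +
       Module.finrank k (X.obj pe) * Module.finrank k (Y.obj pe)) =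
    Module.finrank k (X ⟶ Y) +
      (Module.finrank k (X.obj pb) * Module.finrank k (Y.obj pm) +
      Module.finrank k (X.obj pb) * Module.finrank k (Y.obj pe) +
       Module.finrank k (X.obj pm) * Module.finrank k (Y.obj pe)) := by
  have : Projective (resolution X).X₂ := inferInstanceAs (Projective (cover X))
  have : Module.Finite k ((resolution X).X₁ ⟶ Y) :=
    inferInstanceAs (Module.Finite k (relations X ⟶ Y))
  have : Module.Finite k ((resolution X).X₂ ⟶ Y) :=
    inferInstanceAs (Module.Finite k (cover X ⟶ Y))
  have h := finrank_ext_one_of_projective k Y (resolution_shortExact X)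
  have h1 : Module.finrank k ((resolution X).X₁ ⟶ Y) = _ :=
    finrank_free_hom (A := PUnit.{u + 1}) (B := X.obj pb) (C := X.obj pb × X.obj pm) Y
  have h2 : Module.finrank k ((resolution X).X₂ ⟶ Y) = _ :=
    finrank_free_hom (A := X.obj pb) (B := X.obj pm) (C := X.obj pe) Y
  rw [h1, h2, Module.finrank_prod, Module.finrank_zero_of_subsingleton (M := PUnit.{u + 1})] at h
  have h3 : Module.finrank k ((resolution X).X₃ ⟶ Y) = Module.finrank k (X ⟶ Y) := rfl
  have h4 : Module.finrank k (Ext (resolution X).X₃ Y 1) = Module.finrank k (Ext X Y 1) := rfl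
  rw [h3, h4] at h
  linarith

/-- The dimensions, in terms of the dimension of the space of morphisms and the Euler form. -/
theorem hasDims_of_finrank {X Y : Rep k} {n e : ℕ} (hn : Module.finrank k (X ⟶ Y) = n)
    (he : e + (Module.finrank k (X.obj pb) * Module.finrank k (Y.obj pb) +
      Module.finrank k (X.obj pm) * Module.finrank k (Y.obj pm) +
       Module.finrank k (X.obj pe) * Module.finrank k (Y.obj pe)) =
    n + (Module.finrank k (X.obj pb) * Module.finrank k (Y.obj pm) +
      Module.finrank k (X.obj pb) * Module.finrank k (Y.obj pe) +
       Module.finrank k (X.obj pm) * Module.finrank k (Y.obj pe))) :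
    HasDims k X Y n e := by
  have := finite_ext_one X Y
  have h := finrank_ext_one_add X Y
  refine ⟨?_, ?_⟩
  · rw [← Module.finrank_eq_rank, hn]
  · rw [← Module.finrank_eq_rank]
    congr 1
    omega

/-- Only degree one matters, because the resolution has length one. -/
theorem isExceptional_iff (X : Rep k) : IsExceptional k X ↔ HasDims k X X 1 0 := by
  have := finite_ext_one X X
  unfold IsExceptional HasDims
  rw [Nat.cast_one, Nat.cast_zero, rank_zero_iff]
  refine and_congr_right fun _ => ⟨fun h => h 1 le_rfl, fun h i hi => ?_⟩
  obtain rfl | ⟨n, rfl⟩ : i = 1 ∨ ∃ n, i = n + 2 := by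
    rcases i with _ | _ | n
    · omega
    · exact Or.inl rfl
    · exact Or.inr ⟨n, rfl⟩
  · exact h
  · exact subsingleton_ext X X n

end Dimensions

/-! ### Matrix entries and upper bounds for spaces of morphisms -/

section Entries

variable {k : Type u} [Field k]

/-- The entry `(i, j)` of a linear map, and zero out of range. -/
def ent {a b : ℕ} (i j : ℕ) : ((Fin b → k) →ₗ[k] (Fin a → k)) →ₗ[k] k :=
  if h : i < a ∧ j < b then
    LinearMap.proj ⟨i, h.1⟩ ∘ₗ LinearMap.applyₗ (Pi.single ⟨j, h.2⟩ 1)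
  else 0

section General

variable {a b : ℕ} (A : (Fin b → k) →ₗ[k] (Fin a → k)) {i j : ℕ}

theorem ent_of_lt (hi : i < a) (hj : j < b) : ent i j A = A (Pi.single ⟨j, hj⟩ 1) ⟨i, hi⟩ := by
  rw [ent, dif_pos ⟨hi, hj⟩]
  rfl

theorem ent_of_row_le (hi : a ≤ i) : ent i j A = 0 := by
  rw [ent, dif_neg (by omega), LinearMap.zero_apply]

theorem ent_of_col_le (hj : b ≤ j) : ent i j A = 0 := by
  rw [ent, dif_neg (by omega), LinearMap.zero_apply]

theorem eq_zero_of_ent (h : ∀ i j, ent i j A = 0) : A = 0 := by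
  refine LinearMap.pi_ext' fun j => LinearMap.ext_ring (funext fun i => ?_)
  have := h i j
  rw [ent_of_lt A i.2 j.2] at this
  simpa using this

end General

section Structure

variable {a m n : ℕ}

/-- Composing with `piPlus` on the right appends a zero column. As entries out of range are zero,
the identity holds for all indices; restrictions appear below only where a last row or column is
deleted. -/
theorem ent_comp_piPlus (C : (Fin m → k) →ₗ[k] (Fin a → k)) (i j : ℕ) :
    ent i j (C ∘ₗ piPlus k m) = ent i j C := by
  rcases le_or_gt a i with hi | hi
  · rw [ent_of_row_le _ hi, ent_of_row_le _ hi]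
  rcases lt_trichotomy j m with hj | rfl | hj
  · rw [ent_of_lt _ hi hj, ent_of_lt _ hi (by omega), LinearMap.comp_apply]
    refine congrFun (congrArg C ?_) _
    funext t
    simp [piPlus, Pi.single_apply, Fin.ext_iff]
  · rw [ent_of_col_le _ le_rfl, ent_of_lt _ hi (by omega), LinearMap.comp_apply]
    have : piPlus k j (Pi.single ⟨j, by omega⟩ 1) = 0 := by
      funext t
      have := t.2
      simp [piPlus, Pi.single_apply, Fin.ext_iff]
      omega
    rw [this, map_zero, Pi.zero_apply]
  · rw [ent_of_col_le _ (by omega), ent_of_col_le _ (by omega)]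

theorem ent_comp_piMinus_zero (C : (Fin m → k) →ₗ[k] (Fin a → k)) (i : ℕ) :
    ent i 0 (C ∘ₗ piMinus k m) = 0 := by
  rcases le_or_gt a i with hi | hi
  · rw [ent_of_row_le _ hi]
  · rw [ent_of_lt _ hi (by omega), LinearMap.comp_apply]
    have : piMinus k m (Pi.single ⟨0, by omega⟩ 1) = 0 := by
      funext t
      simp [piMinus, Fin.ext_iff]
    rw [this, map_zero, Pi.zero_apply]

theorem ent_comp_piMinus_succ (C : (Fin m → k) →ₗ[k] (Fin a → k)) (i j : ℕ) :
    ent i (j + 1) (C ∘ₗ piMinus k m) = ent i j C := by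
  rcases le_or_gt a i with hi | hi
  · rw [ent_of_row_le _ hi, ent_of_row_le _ hi]
  rcases le_or_gt m j with hj | hj
  · rw [ent_of_col_le _ (by omega), ent_of_col_le _ (by omega)]
  · rw [ent_of_lt _ hi hj, ent_of_lt _ hi (by omega), LinearMap.comp_apply]
    refine congrFun (congrArg C ?_) _
    funext t
    simp [piMinus, Pi.single_apply, Fin.ext_iff]

theorem jPlus_single (j : ℕ) (hj : j < m) :
    jPlus k m (Pi.single ⟨j, hj⟩ 1) = Pi.single ⟨j, by omega⟩ 1 := by
  funext t
  refine Fin.lastCases ?_ (fun t => ?_) t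
  · simp [jPlus, Pi.single_apply, Fin.ext_iff]
    omega
  · simp [jPlus, Pi.single_apply, Fin.ext_iff]

theorem jMinus_single (j : ℕ) (hj : j < m) :
    jMinus k m (Pi.single ⟨j, hj⟩ 1) = Pi.single ⟨j + 1, by omega⟩ 1 := by
  funext t
  refine Fin.cases ?_ (fun t => ?_) t
  · simp [jMinus, Fin.ext_iff]
  · simp [jMinus, Pi.single_apply, Fin.ext_iff]

theorem ent_comp_jPlus (C : (Fin (m + 1) → k) →ₗ[k] (Fin a → k)) (i : ℕ) {j : ℕ} (hj : j < m) :
    ent i j (C ∘ₗ jPlus k m) = ent i j C := by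
  rcases le_or_gt a i with hi | hi
  · rw [ent_of_row_le _ hi, ent_of_row_le _ hi]
  · rw [ent_of_lt _ hi hj, ent_of_lt _ hi (by omega), LinearMap.comp_apply, jPlus_single]

theorem ent_comp_jMinus (C : (Fin (m + 1) → k) →ₗ[k] (Fin a → k)) (i : ℕ) {j : ℕ} (hj : j < m) :
    ent i j (C ∘ₗ jMinus k m) = ent i (j + 1) C := by
  rcases le_or_gt a i with hi | hi
  · rw [ent_of_row_le _ hi, ent_of_row_le _ hi]
  · rw [ent_of_lt _ hi hj, ent_of_lt _ hi (by omega), LinearMap.comp_apply, jMinus_single]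

theorem ent_piPlus_comp (A : (Fin a → k) →ₗ[k] (Fin (n + 1) → k)) {i : ℕ} (j : ℕ) (hi : i < n) :
    ent i j (piPlus k n ∘ₗ A) = ent i j A := by
  rcases le_or_gt a j with hj | hj
  · rw [ent_of_col_le _ hj, ent_of_col_le _ hj]
  · rw [ent_of_lt _ hi hj, ent_of_lt _ (by omega) hj]
    rfl

theorem ent_piMinus_comp (A : (Fin a → k) →ₗ[k] (Fin (n + 1) → k)) (i j : ℕ) :
    ent i j (piMinus k n ∘ₗ A) = ent (i + 1) j A := by
  rcases le_or_gt a j with hj | hj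
  · rw [ent_of_col_le _ hj, ent_of_col_le _ hj]
  rcases le_or_gt n i with hi | hi
  · rw [ent_of_row_le _ hi, ent_of_row_le _ (by omega)]
  · rw [ent_of_lt _ hi hj, ent_of_lt _ (by omega) hj]
    rfl

theorem ent_jPlus_comp (A : (Fin a → k) →ₗ[k] (Fin n → k)) (i j : ℕ) :
    ent i j (jPlus k n ∘ₗ A) = ent i j A := by
  rcases le_or_gt a j with hj | hj
  · rw [ent_of_col_le _ hj, ent_of_col_le _ hj]
  rcases lt_trichotomy i n with hi | rfl | hi
  · rw [ent_of_lt _ hi hj, ent_of_lt _ (by omega) hj]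
    exact Fin.snoc_castSucc (α := fun _ => k) (i := ⟨i, hi⟩) ..
  · rw [ent_of_row_le _ le_rfl, ent_of_lt _ (by omega) hj]
    exact Fin.snoc_last (α := fun _ => k) ..
  · rw [ent_of_row_le _ (by omega), ent_of_row_le _ (by omega)]

theorem ent_jMinus_comp_zero (A : (Fin a → k) →ₗ[k] (Fin n → k)) (j : ℕ) :
    ent 0 j (jMinus k n ∘ₗ A) = 0 := by
  rcases le_or_gt a j with hj | hj
  · rw [ent_of_col_le _ hj]
  · rw [ent_of_lt _ (by omega) hj]
    rfl

theorem ent_jMinus_comp_succ (A : (Fin a → k) →ₗ[k] (Fin n → k)) (i j : ℕ) :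
    ent (i + 1) j (jMinus k n ∘ₗ A) = ent i j A := by
  rcases le_or_gt a j with hj | hj
  · rw [ent_of_col_le _ hj, ent_of_col_le _ hj]
  rcases le_or_gt n i with hi | hi
  · rw [ent_of_row_le _ hi, ent_of_row_le _ (by omega)]
  · rw [ent_of_lt _ hi hj, ent_of_lt _ (by omega) hj]
    rfl

end Structure

section Relations

variable {a m n : ℕ}

theorem rel_piPlus_piPlus {A : (Fin (m + 1) → k) →ₗ[k] (Fin (n + 1) → k)}
    {C : (Fin m → k) →ₗ[k] (Fin n → k)} (h : piPlus k n ∘ₗ A = C ∘ₗ piPlus k m) (i j : ℕ)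
    (hi : i < n) : ent i j A = ent i j C := by
  rw [← ent_piPlus_comp A j hi, h, ent_comp_piPlus]

theorem rel_piPlus_jPlus {A : (Fin m → k) →ₗ[k] (Fin (n + 1) → k)}
    {C : (Fin (m + 1) → k) →ₗ[k] (Fin n → k)} (h : piPlus k n ∘ₗ A = C ∘ₗ jPlus k m) (i j : ℕ)
    (hi : i < n) (hj : j < m) : ent i j A = ent i j C := by
  rw [← ent_piPlus_comp A j hi, h, ent_comp_jPlus _ _ hj]

theorem rel_jPlus_jPlus {A : (Fin m → k) →ₗ[k] (Fin n → k)}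
    {C : (Fin (m + 1) → k) →ₗ[k] (Fin (n + 1) → k)} (h : jPlus k n ∘ₗ A = C ∘ₗ jPlus k m)
    (i j : ℕ) (hj : j < m) : ent i j A = ent i j C := by
  rw [← ent_jPlus_comp A i j, h, ent_comp_jPlus _ _ hj]

theorem rel_jPlus_piPlus {A : (Fin (m + 1) → k) →ₗ[k] (Fin n → k)}
    {C : (Fin m → k) →ₗ[k] (Fin (n + 1) → k)} (h : jPlus k n ∘ₗ A = C ∘ₗ piPlus k m)
    (i j : ℕ) : ent i j A = ent i j C := by
  rw [← ent_jPlus_comp A i j, h, ent_comp_piPlus]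

theorem rel_piMinus {A : (Fin a → k) →ₗ[k] (Fin (n + 1) → k)}
    {B : (Fin a → k) →ₗ[k] (Fin n → k)} (h : piMinus k n ∘ₗ A = B) (i j : ℕ) :
    ent (i + 1) j A = ent i j B := by
  rw [← ent_piMinus_comp, h]

theorem rel_jMinus_zero {A : (Fin a → k) →ₗ[k] (Fin n → k)}
    {B : (Fin a → k) →ₗ[k] (Fin (n + 1) → k)} (h : jMinus k n ∘ₗ A = B) (j : ℕ) :
    ent 0 j B = 0 := by
  rw [← h, ent_jMinus_comp_zero]

theorem rel_jMinus_succ {A : (Fin a → k) →ₗ[k] (Fin n → k)}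
    {B : (Fin a → k) →ₗ[k] (Fin (n + 1) → k)} (h : jMinus k n ∘ₗ A = B) (i j : ℕ) :
    ent (i + 1) j B = ent i j A := by
  rw [← h, ent_jMinus_comp_succ]

end Relations

section Toeplitz

theorem toeplitz_shift {R : Type*} {T : ℕ → ℕ → R} {n m : ℕ}
    (hT : ∀ i j, i < n → j < m → T (i + 1) (j + 1) = T i j) (d i j : ℕ) (hi : i + d ≤ n)
    (hj : j + d ≤ m) : T (i + d) (j + d) = T i j := by
  induction d with
  | zero => rfl
  | succ d ih =>
    rw [← add_assoc, ← add_assoc, hT _ _ (by omega) (by omega), ih (by omega) (by omega)]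

/-- A Toeplitz matrix with zero first column below the corner and zero last column above the
corner is determined by the beginning of its first row. -/
theorem toeplitz_eq_zero {T : ℕ → ℕ → k} {n m : ℕ}
    (hT : ∀ i j, i < n → j < m → T (i + 1) (j + 1) = T i j)
    (h0 : ∀ i, i < n → T (i + 1) 0 = 0) (hm : ∀ i, i < n → T i m = 0)
    (hr : ∀ s, s < m + 1 - n → T 0 s = 0) (i j : ℕ) (hi : i ≤ n) (hj : j ≤ m) : T i j = 0 := by
  rcases lt_or_ge j i with h | h
  · have := toeplitz_shift hT j (i - j) 0 (by omega) (by omega)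
    rw [zero_add, Nat.sub_add_cancel h.le] at this
    rw [this, show i - j = i - j - 1 + 1 by omega, h0 _ (by omega)]
  · have h1 := toeplitz_shift hT i 0 (j - i) (by omega) (by omega)
    rw [zero_add, Nat.sub_add_cancel h] at h1
    rw [h1]
    rcases lt_or_ge (j - i) (m + 1 - n) with h2 | h2
    · exact hr _ h2
    · have h3 := toeplitz_shift hT (m - (j - i)) 0 (j - i) (by omega) (by omega)
      rw [← h3, zero_add, Nat.add_sub_cancel' (by omega), hm _ (by omega)]

theorem toeplitz_eq_zero' {T : ℕ → ℕ → k} {n m : ℕ}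
    (hT : ∀ i j, i < n → j < m → T (i + 1) (j + 1) = T i j)
    (h0 : ∀ j, j < m → T 0 (j + 1) = 0) (hn : ∀ j, j < m → T n j = 0)
    (hr : ∀ s, s < n + 1 - m → T s 0 = 0) (i j : ℕ) (hi : i ≤ n) (hj : j ≤ m) : T i j = 0 :=
  toeplitz_eq_zero (T := fun i j => T j i) (fun i j hi hj => hT j i hj hi) h0 hn hr j i hj hi

end Toeplitz

section Bound

variable {α β γ α' β' γ' : ℕ}

/-- If the joint kernel of `N` functionals on the space of morphisms is zero, the space embeds in
`k^N`. The functionals used below are single matrix entries. -/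
theorem finrank_homSub_le {f : (Fin α → k) →ₗ[k] (Fin γ → k)} {g : (Fin α → k) →ₗ[k] (Fin β → k)}
    {h : (Fin β → k) →ₗ[k] (Fin γ → k)} {f' : (Fin α' → k) →ₗ[k] (Fin γ' → k)}
    {g' : (Fin α' → k) →ₗ[k] (Fin β' → k)} {h' : (Fin β' → k) →ₗ[k] (Fin γ' → k)} {N : ℕ}
    (Φ : Fin N → (((Fin α → k) →ₗ[k] (Fin α' → k)) × ((Fin β → k) →ₗ[k] (Fin β' → k)) ×
      ((Fin γ → k) →ₗ[k] (Fin γ' → k)) →ₗ[k] k))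
    (hΦ : ∀ A B C, f' ∘ₗ A = C ∘ₗ f → g' ∘ₗ A = B ∘ₗ g → h' ∘ₗ B = C ∘ₗ h →
      (∀ s, Φ s (A, B, C) = 0) →
      (∀ i j, ent i j A = 0) ∧ (∀ i j, ent i j B = 0) ∧ (∀ i j, ent i j C = 0)) :
    Module.finrank k (homSub f g h f' g' h') ≤ N := by
  have := LinearMap.finrank_le_finrank_of_injective
    (f := LinearMap.pi Φ ∘ₗ (homSub f g h f' g' h').subtype) (by
      rw [injective_iff_map_eq_zero]
      rintro ⟨⟨A, B, C⟩, h1, h2, h3⟩ h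
      obtain ⟨hA, hB, hC⟩ := hΦ A B C h1 h2 h3 (fun s => congrFun h s)
      exact Subtype.ext (Prod.ext (eq_zero_of_ent A hA)
        (Prod.ext (eq_zero_of_ent B hB) (eq_zero_of_ent C hC))))
  simpa using this

theorem finrank_rep_hom (f : (Fin α → k) →ₗ[k] (Fin γ → k)) (g : (Fin α → k) →ₗ[k] (Fin β → k))
    (h : (Fin β → k) →ₗ[k] (Fin γ → k)) (f' : (Fin α' → k) →ₗ[k] (Fin γ' → k))
    (g' : (Fin α' → k) →ₗ[k] (Fin β' → k)) (h' : (Fin β' → k) →ₗ[k] (Fin γ' → k)) :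
    Module.finrank k (rep k f g h ⟶ rep k f' g' h') =
      Module.finrank k (homSub f g h f' g' h') := by
  have := (homLinearEquiv (ofMaps f g h) (ofMaps f' g' h')).finrank_eq
  rw [be_ofMaps, bm_ofMaps, me_ofMaps, be_ofMaps, bm_ofMaps, me_ofMaps] at this
  exact this

theorem finrank_rep_obj (f : (Fin α → k) →ₗ[k] (Fin γ → k)) (g : (Fin α → k) →ₗ[k] (Fin β → k))
    (h : (Fin β → k) →ₗ[k] (Fin γ → k)) : Module.finrank k ((rep k f g h).obj pb) = α ∧
      Module.finrank k ((rep k f g h).obj pm) = β ∧ Module.finrank k ((rep k f g h).obj pe) = γ :=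
  ⟨Module.finrank_fin_fun k, Module.finrank_fin_fun k, Module.finrank_fin_fun k⟩

/-- The Euler form gives `hom - hom¹ = n - e`. If `e = 0` then `hom ≥ n`, and if `n = 0` then `hom ≥
0 = n` trivially; either way the upper bound forces `hom = n`, and then `hom¹ = e`. -/
theorem hasDims_rep {f : (Fin α → k) →ₗ[k] (Fin γ → k)} {g : (Fin α → k) →ₗ[k] (Fin β → k)}
    {h : (Fin β → k) →ₗ[k] (Fin γ → k)} {f' : (Fin α' → k) →ₗ[k] (Fin γ' → k)}
    {g' : (Fin α' → k) →ₗ[k] (Fin β' → k)} {h' : (Fin β' → k) →ₗ[k] (Fin γ' → k)} {n e : ℕ}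
    (hle : Module.finrank k (homSub f g h f' g' h') ≤ n)
    (hχ : e + (α * α' + β * β' + γ * γ') = n + (α * β' + α * γ' + β * γ'))
    (h0 : n = 0 ∨ e = 0) : HasDims k (rep k f g h) (rep k f' g' h') n e := by
  have key := finrank_ext_one_add (rep k f g h) (rep k f' g' h')
  obtain ⟨d1, d2, d3⟩ := finrank_rep_obj f g h
  obtain ⟨d4, d5, d6⟩ := finrank_rep_obj f' g' h'
  rw [← finrank_rep_hom] at hle
  rw [d1, d2, d3, d4, d5, d6] at key
  apply hasDims_of_finrank
  · omega
  · rw [d1, d2, d3, d4, d5, d6, hχ]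

end Bound

end Entries

variable {k : Type u} [Field k]

/-! ### Morphisms among `E1` and `E4`: Toeplitz matrices -/

section Preinjective

variable (m n : ℕ)

/-- Comparing the `piPlus` and `piMinus` relations makes the component at `b` Toeplitz, with first
column zero below the corner and last column zero above the bottom row. The first `m + 1 - n`
entries of the first row are the free parameters. -/
theorem finrank_hom_E1_E1 : Module.finrank k (homSub (piPlus k m) (piMinus k m) LinearMap.id
    (piPlus k n) (piMinus k n) LinearMap.id) ≤ m + 1 - n := by
  refine finrank_homSub_le (fun s => ent 0 s ∘ₗ LinearMap.fst k _ _) fun A B C h1 h2 h3 hΦ => ?_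
  obtain rfl : B = C := h3
  have e1 := rel_piPlus_piPlus h1
  have e2 := rel_piMinus h2
  have e3 := ent_comp_piMinus_zero B
  have e4 := ent_comp_piMinus_succ B
  have hA : ∀ i j, i ≤ n → j ≤ m → ent i j A = 0 :=
    toeplitz_eq_zero (by grind) (by grind) (by grind [ent_of_col_le]) fun s hs => hΦ ⟨s, hs⟩
  grind [ent_of_col_le, ent_of_row_le]

theorem finrank_hom_E4_E4 : Module.finrank k (homSub (piPlus k m) LinearMap.id (piMinus k m)
    (piPlus k n) LinearMap.id (piMinus k n)) ≤ m + 1 - n := by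
  refine finrank_homSub_le (fun s => ent 0 s ∘ₗ LinearMap.fst k _ _) fun A B C h1 h2 h3 hΦ => ?_
  obtain rfl : A = B := h2
  have e1 := rel_piPlus_piPlus h1
  have e2 := rel_piMinus h3
  have e3 := ent_comp_piMinus_zero C
  have e4 := ent_comp_piMinus_succ C
  have hA : ∀ i j, i ≤ n → j ≤ m → ent i j A = 0 :=
    toeplitz_eq_zero (by grind) (by grind) (by grind [ent_of_col_le]) fun s hs => hΦ ⟨s, hs⟩
  grind [ent_of_col_le, ent_of_row_le]

theorem finrank_hom_E4_E1 : Module.finrank k (homSub (piPlus k m) LinearMap.id (piMinus k m)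
    (piPlus k n) (piMinus k n) LinearMap.id) ≤ m + 1 - n := by
  refine finrank_homSub_le (fun s => ent 0 s ∘ₗ LinearMap.fst k _ _) fun A B C h1 h2 h3 hΦ => ?_
  obtain rfl : B = C ∘ₗ piMinus k m := h3
  have e1 := rel_piPlus_piPlus h1
  have e2 : ∀ i j, ent (i + 1) j A = ent i j (C ∘ₗ piMinus k m) := rel_piMinus h2
  have e3 := ent_comp_piMinus_zero C
  have e4 := ent_comp_piMinus_succ C
  have hA : ∀ i j, i ≤ n → j ≤ m → ent i j A = 0 :=
    toeplitz_eq_zero (by grind) (by grind) (by grind [ent_of_col_le]) fun s hs => hΦ ⟨s, hs⟩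
  grind [ent_of_col_le, ent_of_row_le]

/-- Here the component at `b` factors through `piMinus`, so its entire first column vanishes, corner
included; this costs one parameter compared with the other cases, hence the shift `s + 1`. -/
theorem finrank_hom_E1_E4 : Module.finrank k (homSub (piPlus k m) (piMinus k m) LinearMap.id
    (piPlus k n) LinearMap.id (piMinus k n)) ≤ m - n := by
  refine finrank_homSub_le (fun s => ent 0 (s + 1) ∘ₗ LinearMap.fst k _ _)
    fun A B C h1 h2 h3 hΦ => ?_
  obtain rfl : A = B ∘ₗ piMinus k m := h2
  have e1 := rel_piPlus_piPlus h1
  have e2 : ∀ i j, ent (i + 1) j B = ent i j C := rel_piMinus h3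
  have e3 := ent_comp_piMinus_zero B
  have e4 := ent_comp_piMinus_succ B
  have hA : ∀ i j, i ≤ n → j ≤ m → ent i j (B ∘ₗ piMinus k m) = 0 := by
    refine toeplitz_eq_zero (by grind) (by grind) (by grind [ent_of_col_le]) fun s hs => ?_
    rcases s with _ | s
    · exact e3 0
    · exact hΦ ⟨s, by omega⟩
  grind [ent_of_col_le, ent_of_row_le]

end Preinjective

/-! ### Morphisms among `E2` and `E3`: transposed Toeplitz matrices -/

section Preprojective

variable (m n : ℕ)

/-- The transposed situation: the component at `e` is Toeplitz, its first row vanishes past the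
corner and its last row before the last column, so the beginning of the first column determines it.
-/
theorem finrank_hom_E2_E2 : Module.finrank k (homSub (jPlus k m) (jMinus k m) LinearMap.id
    (jPlus k n) (jMinus k n) LinearMap.id) ≤ n + 1 - m := by
  refine finrank_homSub_le (fun s => ent s 0 ∘ₗ LinearMap.snd k _ _ ∘ₗ LinearMap.snd k _ _)
    fun A B C h1 h2 h3 hΦ => ?_
  obtain rfl : B = C := h3
  have e1 := rel_jPlus_jPlus h1
  have e2 := rel_jMinus_zero h2
  have e3 := rel_jMinus_succ h2
  have e4 := fun i j => ent_comp_jMinus B i (j := j)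
  have hC : ∀ i j, i ≤ n → j ≤ m → ent i j B = 0 :=
    toeplitz_eq_zero' (by grind) (by grind) (by grind [ent_of_row_le]) fun s hs => hΦ ⟨s, hs⟩
  grind [ent_of_col_le, ent_of_row_le]

theorem finrank_hom_E3_E3 : Module.finrank k (homSub (jPlus k m) LinearMap.id (jMinus k m)
    (jPlus k n) LinearMap.id (jMinus k n)) ≤ n + 1 - m := by
  refine finrank_homSub_le (fun s => ent s 0 ∘ₗ LinearMap.snd k _ _ ∘ₗ LinearMap.snd k _ _)
    fun A B C h1 h2 h3 hΦ => ?_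
  obtain rfl : A = B := h2
  have e1 := rel_jPlus_jPlus h1
  have e2 := rel_jMinus_zero h3
  have e3 := rel_jMinus_succ h3
  have e4 := fun i j => ent_comp_jMinus C i (j := j)
  have hC : ∀ i j, i ≤ n → j ≤ m → ent i j C = 0 :=
    toeplitz_eq_zero' (by grind) (by grind) (by grind [ent_of_row_le]) fun s hs => hΦ ⟨s, hs⟩
  grind [ent_of_col_le, ent_of_row_le]

theorem finrank_hom_E3_E2 : Module.finrank k (homSub (jPlus k m) LinearMap.id (jMinus k m)
    (jPlus k n) (jMinus k n) LinearMap.id) ≤ n + 1 - m := by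
  refine finrank_homSub_le (fun s => ent s 0 ∘ₗ LinearMap.snd k _ _ ∘ₗ LinearMap.snd k _ _)
    fun A B C h1 h2 h3 hΦ => ?_
  obtain rfl : B = C ∘ₗ jMinus k m := h3
  have e1 := rel_jPlus_jPlus h1
  have e2 : ∀ j, ent 0 j (C ∘ₗ jMinus k m) = 0 := rel_jMinus_zero h2
  have e3 : ∀ i j, ent (i + 1) j (C ∘ₗ jMinus k m) = ent i j A := rel_jMinus_succ h2
  have e4 := fun i j => ent_comp_jMinus C i (j := j)
  have hC : ∀ i j, i ≤ n → j ≤ m → ent i j C = 0 :=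
    toeplitz_eq_zero' (by grind) (by grind) (by grind [ent_of_row_le]) fun s hs => hΦ ⟨s, hs⟩
  grind [ent_of_col_le, ent_of_row_le]

/-- The component at `e` has zero first row, corner included, because of the final `jMinus`; again
one parameter is lost. -/
theorem finrank_hom_E2_E3 : Module.finrank k (homSub (jPlus k m) (jMinus k m) LinearMap.id
    (jPlus k n) LinearMap.id (jMinus k n)) ≤ n - m := by
  refine finrank_homSub_le (fun s => ent (s + 1) 0 ∘ₗ LinearMap.snd k _ _ ∘ₗ LinearMap.snd k _ _)
    fun A B C h1 h2 h3 hΦ => ?_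
  obtain rfl : A = B ∘ₗ jMinus k m := h2
  have e1 := rel_jPlus_jPlus h1
  have e2 : ∀ j, ent 0 j C = 0 := rel_jMinus_zero h3
  have e3 : ∀ i j, ent (i + 1) j C = ent i j B := rel_jMinus_succ h3
  have e4 := fun i j => ent_comp_jMinus B i (j := j)
  have hC : ∀ i j, i ≤ n → j ≤ m → ent i j C = 0 := by
    refine toeplitz_eq_zero' (by grind) (by grind) (by grind [ent_of_row_le]) fun s hs => ?_
    rcases s with _ | s
    · exact e2 0
    · exact hΦ ⟨s, by omega⟩
  grind [ent_of_col_le, ent_of_row_le]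

end Preprojective

/-! ### Morphisms from `E2`, `E3` to `E1`, `E4`: Hankel matrices -/

section PreprojectivePreinjective

variable (m n : ℕ)

/-- The relations say that moving one column right in `C` equals moving one row down in `A`, and
that `A` and `C` agree where both are defined. This Hankel pattern is recovered column by column
from the `n` entries of the first column of `C` and the `m` entries of the last row of `A`. -/
theorem finrank_hom_E2_E1 : Module.finrank k (homSub (jPlus k m) (jMinus k m) LinearMap.id
    (piPlus k n) (piMinus k n) LinearMap.id) ≤ n + m := by
  refine finrank_homSub_le (fun s => if s.1 < n then
      ent s 0 ∘ₗ LinearMap.snd k _ _ ∘ₗ LinearMap.snd k _ _ else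
      ent n (s - n) ∘ₗ LinearMap.fst k _ _) fun A B C h1 h2 h3 hΦ => ?_
  obtain rfl : B = C := h3
  have e1 := rel_piPlus_jPlus h1
  have e2 := rel_piMinus h2
  have e4 := fun i j => ent_comp_jMinus B i (j := j)
  have h0 : ∀ i, i < n → ent i 0 B = 0 := fun i hi => by
    simpa [hi] using hΦ ⟨i, by omega⟩
  have hn : ∀ j, j < m → ent n j A = 0 := fun j hj => by
    simpa using hΦ ⟨n + j, by omega⟩
  have hC : ∀ j i, ent i j B = 0 := by
    intro j
    induction j with
    | zero => grind [ent_of_row_le]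
    | succ j ih => grind [ent_of_row_le, ent_of_col_le]
  grind [ent_of_col_le, ent_of_row_le]

theorem finrank_hom_E3_E1 : Module.finrank k (homSub (jPlus k m) LinearMap.id (jMinus k m)
    (piPlus k n) (piMinus k n) LinearMap.id) ≤ n + m := by
  refine finrank_homSub_le (fun s => if s.1 < n then
      ent s 0 ∘ₗ LinearMap.snd k _ _ ∘ₗ LinearMap.snd k _ _ else
      ent n (s - n) ∘ₗ LinearMap.fst k _ _) fun A B C h1 h2 h3 hΦ => ?_
  obtain rfl : B = C ∘ₗ jMinus k m := h3
  have e1 := rel_piPlus_jPlus h1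
  have e2 : ∀ i j, ent (i + 1) j A = ent i j (C ∘ₗ jMinus k m) := rel_piMinus h2
  have e4 := fun i j => ent_comp_jMinus C i (j := j)
  have h0 : ∀ i, i < n → ent i 0 C = 0 := fun i hi => by
    simpa [hi] using hΦ ⟨i, by omega⟩
  have hn : ∀ j, j < m → ent n j A = 0 := fun j hj => by
    simpa using hΦ ⟨n + j, by omega⟩
  have hC : ∀ j i, ent i j C = 0 := by
    intro j
    induction j with
    | zero => grind [ent_of_row_le]
    | succ j ih => grind [ent_of_row_le, ent_of_col_le]
  grind [ent_of_col_le, ent_of_row_le]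

theorem finrank_hom_E3_E4 : Module.finrank k (homSub (jPlus k m) LinearMap.id (jMinus k m)
    (piPlus k n) LinearMap.id (piMinus k n)) ≤ n + m := by
  refine finrank_homSub_le (fun s => if s.1 < n then
      ent s 0 ∘ₗ LinearMap.snd k _ _ ∘ₗ LinearMap.snd k _ _ else
      ent n (s - n) ∘ₗ LinearMap.fst k _ _) fun A B C h1 h2 h3 hΦ => ?_
  obtain rfl : A = B := h2
  have e1 := rel_piPlus_jPlus h1
  have e2 := rel_piMinus h3
  have e4 := fun i j => ent_comp_jMinus C i (j := j)
  have h0 : ∀ i, i < n → ent i 0 C = 0 := fun i hi => by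
    simpa [hi] using hΦ ⟨i, by omega⟩
  have hn : ∀ j, j < m → ent n j A = 0 := fun j hj => by
    simpa using hΦ ⟨n + j, by omega⟩
  have hC : ∀ j i, ent i j C = 0 := by
    intro j
    induction j with
    | zero => grind [ent_of_row_le]
    | succ j ih => grind [ent_of_row_le, ent_of_col_le]
  grind [ent_of_col_le, ent_of_row_le]

/-- Now the component at `mid` is itself an `(n+1) × (m+1)` Hankel matrix, determined by its first
column and last row. The corner they share is counted once: for `s ≥ n + 1` the column `s - n` is at
least 1. -/
theorem finrank_hom_E2_E4 : Module.finrank k (homSub (jPlus k m) (jMinus k m) LinearMap.id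
    (piPlus k n) LinearMap.id (piMinus k n)) ≤ 1 + n + m := by
  refine finrank_homSub_le (fun s => if s.1 < n + 1 then
      ent s 0 ∘ₗ LinearMap.fst k _ _ ∘ₗ LinearMap.snd k _ _ else
      ent n (s - n) ∘ₗ LinearMap.fst k _ _ ∘ₗ LinearMap.snd k _ _) fun A B C h1 h2 h3 hΦ => ?_
  obtain rfl : A = B ∘ₗ jMinus k m := h2
  have e1 := rel_piPlus_jPlus h1
  have e2 : ∀ i j, ent (i + 1) j B = ent i j C := rel_piMinus h3
  have e4 := fun i j => ent_comp_jMinus B i (j := j)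
  have h0 : ∀ i, i < n + 1 → ent i 0 B = 0 := fun i hi => by
    simpa [hi] using hΦ ⟨i, by omega⟩
  have hn : ∀ j, j < m → ent n (j + 1) B = 0 := fun j hj => by
    have := hΦ ⟨n + 1 + j, by omega⟩
    rw [if_neg (by simp; omega)] at this
    rw [← this, show (⟨n + 1 + j, by omega⟩ : Fin (1 + n + m)).1 - n = j + 1 by simp; omega]
    rfl
  have hC : ∀ j i, ent i j B = 0 := by
    intro j
    induction j with
    | zero => grind [ent_of_row_le]
    | succ j ih => grind [ent_of_row_le, ent_of_col_le]
  grind [ent_of_col_le, ent_of_row_le]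

end PreprojectivePreinjective

/-! ### No morphisms from `E1`, `E4` to `E2`, `E3` -/

section PreinjectivePreprojective

variable (m n : ℕ)

/-- Column 0 of `A` vanishes, and each next column is the previous one shifted by a row, with zeros
out of range; so all columns vanish by induction. -/
theorem finrank_hom_E1_E2 : Module.finrank k (homSub (piPlus k m) (piMinus k m) LinearMap.id
    (jPlus k n) (jMinus k n) LinearMap.id) ≤ 0 := by
  refine finrank_homSub_le Fin.elim0 fun A B C h1 h2 h3 _ => ?_
  obtain rfl : B = C := h3
  have e1 := rel_jPlus_piPlus h1
  have e2 := rel_jMinus_succ h2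
  have e3 := ent_comp_piMinus_zero B
  have e4 := ent_comp_piMinus_succ B
  have hA : ∀ j i, ent i j A = 0 := by
    intro j
    induction j <;> grind
  grind

theorem finrank_hom_E1_E3 : Module.finrank k (homSub (piPlus k m) (piMinus k m) LinearMap.id
    (jPlus k n) LinearMap.id (jMinus k n)) ≤ 0 := by
  refine finrank_homSub_le Fin.elim0 fun A B C h1 h2 h3 _ => ?_
  obtain rfl : A = B ∘ₗ piMinus k m := h2
  have e1 := rel_jPlus_piPlus h1
  have e2 : ∀ i j, ent (i + 1) j C = ent i j B := rel_jMinus_succ h3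
  have e3 := ent_comp_piMinus_zero B
  have e4 := ent_comp_piMinus_succ B
  have hA : ∀ j i, ent i j (B ∘ₗ piMinus k m) = 0 := by
    intro j
    induction j <;> grind
  grind

theorem finrank_hom_E4_E2 : Module.finrank k (homSub (piPlus k m) LinearMap.id (piMinus k m)
    (jPlus k n) (jMinus k n) LinearMap.id) ≤ 0 := by
  refine finrank_homSub_le Fin.elim0 fun A B C h1 h2 h3 _ => ?_
  obtain rfl : B = C ∘ₗ piMinus k m := h3
  have e1 := rel_jPlus_piPlus h1
  have e2 : ∀ i j, ent (i + 1) j (C ∘ₗ piMinus k m) = ent i j A := rel_jMinus_succ h2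
  have e3 := ent_comp_piMinus_zero C
  have e4 := ent_comp_piMinus_succ C
  have hA : ∀ j i, ent i j A = 0 := by
    intro j
    induction j <;> grind
  have hB : ∀ i j, ent i j (C ∘ₗ piMinus k m) = 0 := by
    intro i j
    cases j <;> grind
  grind

theorem finrank_hom_E4_E3 : Module.finrank k (homSub (piPlus k m) LinearMap.id (piMinus k m)
    (jPlus k n) LinearMap.id (jMinus k n)) ≤ 0 := by
  refine finrank_homSub_le Fin.elim0 fun A B C h1 h2 h3 _ => ?_
  obtain rfl : A = B := h2
  have e1 := rel_jPlus_piPlus h1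
  have e2 := rel_jMinus_succ h3
  have e3 := ent_comp_piMinus_zero C
  have e4 := ent_comp_piMinus_succ C
  have hA : ∀ j i, ent i j A = 0 := by
    intro j
    induction j <;> grind
  grind

end PreinjectivePreprojective

variable {k : Type u} [Field k]

/-! ### Morphisms to and from `M` and `M'` -/

section SimpleBounds

variable (m : ℕ)

theorem ent_zero_comp {a b c : ℕ} (A : (Fin a → k) →ₗ[k] (Fin b → k)) (i j : ℕ) :
    ent i j ((0 : (Fin b → k) →ₗ[k] (Fin c → k)) ∘ₗ A) = 0 := by
  rw [LinearMap.zero_comp, map_zero]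

theorem ent_comp_zero {a b c : ℕ} (A : (Fin a → k) →ₗ[k] (Fin b → k)) (i j : ℕ) :
    ent i j (A ∘ₗ (0 : (Fin c → k) →ₗ[k] (Fin a → k))) = 0 := by
  rw [LinearMap.comp_zero, map_zero]

theorem finrank_hom_E1_M : Module.finrank k (homSub (piPlus k m) (piMinus k m) LinearMap.id
    (0 : (Fin 0 → k) →ₗ[k] (Fin 0 → k)) (0 : (Fin 0 → k) →ₗ[k] (Fin 1 → k)) 0) ≤ 0 := by
  refine finrank_homSub_le Fin.elim0 fun A B C h1 h2 h3 _ => ?_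
  have hz := ent_zero_comp (c := 1) A
  rw [h2] at hz
  have e := ent_comp_piMinus_succ B
  grind [ent_of_row_le, ent_of_col_le]

theorem finrank_hom_E2_M : Module.finrank k (homSub (jPlus k m) (jMinus k m) LinearMap.id
    (0 : (Fin 0 → k) →ₗ[k] (Fin 0 → k)) (0 : (Fin 0 → k) →ₗ[k] (Fin 1 → k)) 0) ≤ 1 := by
  refine finrank_homSub_le (fun _ => ent 0 0 ∘ₗ LinearMap.fst k _ _ ∘ₗ LinearMap.snd k _ _)
    fun A B C h1 h2 h3 hΦ => ?_
  have hB : ent 0 0 B = 0 := hΦ 0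
  have hz := ent_zero_comp (c := 1) A
  rw [h2] at hz
  have e := fun i j => ent_comp_jMinus B i (j := j)
  have hB' : ∀ i j, ent i j B = 0 := by
    intro i j
    cases j <;> grind [ent_of_row_le, ent_of_col_le]
  grind [ent_of_row_le, ent_of_col_le]

theorem finrank_hom_E3_M : Module.finrank k (homSub (jPlus k m) LinearMap.id (jMinus k m)
    (0 : (Fin 0 → k) →ₗ[k] (Fin 0 → k)) (0 : (Fin 0 → k) →ₗ[k] (Fin 1 → k)) 0) ≤ 0 := by
  refine finrank_homSub_le Fin.elim0 fun A B C h1 h2 h3 _ => ?_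
  have hz : ∀ i j, ent i j B = 0 := fun i j => by
    rw [← ent_zero_comp A i j, h2, LinearMap.comp_id]
  grind [ent_of_row_le, ent_of_col_le]

theorem finrank_hom_E4_M : Module.finrank k (homSub (piPlus k m) LinearMap.id (piMinus k m)
    (0 : (Fin 0 → k) →ₗ[k] (Fin 0 → k)) (0 : (Fin 0 → k) →ₗ[k] (Fin 1 → k)) 0) ≤ 0 := by
  refine finrank_homSub_le Fin.elim0 fun A B C h1 h2 h3 _ => ?_
  have hz : ∀ i j, ent i j B = 0 := fun i j => by
    rw [← ent_zero_comp A i j, h2, LinearMap.comp_id]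
  grind [ent_of_row_le, ent_of_col_le]

theorem finrank_hom_M_E1 : Module.finrank k (homSub
    (0 : (Fin 0 → k) →ₗ[k] (Fin 0 → k)) (0 : (Fin 0 → k) →ₗ[k] (Fin 1 → k)) 0
    (piPlus k m) (piMinus k m) LinearMap.id) ≤ 0 := by
  refine finrank_homSub_le Fin.elim0 fun A B C h1 h2 h3 _ => ?_
  have hz : ∀ i j, ent i j B = 0 := fun i j => by
    rw [← ent_comp_zero C i j, ← h3, LinearMap.id_comp]
  grind [ent_of_row_le, ent_of_col_le]

theorem finrank_hom_M_E2 : Module.finrank k (homSub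
    (0 : (Fin 0 → k) →ₗ[k] (Fin 0 → k)) (0 : (Fin 0 → k) →ₗ[k] (Fin 1 → k)) 0
    (jPlus k m) (jMinus k m) LinearMap.id) ≤ 0 := by
  refine finrank_homSub_le Fin.elim0 fun A B C h1 h2 h3 _ => ?_
  have hz : ∀ i j, ent i j B = 0 := fun i j => by
    rw [← ent_comp_zero C i j, ← h3, LinearMap.id_comp]
  grind [ent_of_row_le, ent_of_col_le]

theorem finrank_hom_M_E3 : Module.finrank k (homSub
    (0 : (Fin 0 → k) →ₗ[k] (Fin 0 → k)) (0 : (Fin 0 → k) →ₗ[k] (Fin 1 → k)) 0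
    (jPlus k m) LinearMap.id (jMinus k m)) ≤ 0 := by
  refine finrank_homSub_le Fin.elim0 fun A B C h1 h2 h3 _ => ?_
  have e := rel_jMinus_succ h3
  have hz := ent_comp_zero (c := 1) C
  grind [ent_of_row_le, ent_of_col_le]

theorem finrank_hom_M_E4 : Module.finrank k (homSub
    (0 : (Fin 0 → k) →ₗ[k] (Fin 0 → k)) (0 : (Fin 0 → k) →ₗ[k] (Fin 1 → k)) 0
    (piPlus k m) LinearMap.id (piMinus k m)) ≤ 1 := by
  refine finrank_homSub_le (fun _ => ent 0 0 ∘ₗ LinearMap.fst k _ _ ∘ₗ LinearMap.snd k _ _)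
    fun A B C h1 h2 h3 hΦ => ?_
  have hB : ent 0 0 B = 0 := hΦ 0
  have e := rel_piMinus h3
  have hz := ent_comp_zero (c := 1) C
  have hB' : ∀ i j, ent i j B = 0 := by
    intro i j
    cases i <;> grind [ent_of_row_le, ent_of_col_le]
  grind [ent_of_row_le, ent_of_col_le]

theorem finrank_hom_M'_E1 : Module.finrank k (homSub
    (LinearMap.id : (Fin 1 → k) →ₗ[k] (Fin 1 → k)) (0 : (Fin 1 → k) →ₗ[k] (Fin 0 → k)) 0
    (piPlus k m) (piMinus k m) LinearMap.id) ≤ 1 := by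
  refine finrank_homSub_le (fun _ => ent 0 0 ∘ₗ LinearMap.fst k _ _)
    fun A B C h1 h2 h3 hΦ => ?_
  have hA : ent 0 0 A = 0 := hΦ 0
  have e := rel_piMinus h2
  have hz := ent_comp_zero (c := 1) B
  have hA' : ∀ i j, ent i j A = 0 := by
    intro i j
    cases i <;> grind [ent_of_row_le, ent_of_col_le]
  obtain rfl : piPlus k m ∘ₗ A = C := h1
  have e' := fun i j => ent_piPlus_comp A (i := i) j
  grind [ent_of_row_le, ent_of_col_le]

theorem finrank_hom_M'_E2 : Module.finrank k (homSub
    (LinearMap.id : (Fin 1 → k) →ₗ[k] (Fin 1 → k)) (0 : (Fin 1 → k) →ₗ[k] (Fin 0 → k)) 0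
    (jPlus k m) (jMinus k m) LinearMap.id) ≤ 0 := by
  refine finrank_homSub_le Fin.elim0 fun A B C h1 h2 h3 _ => ?_
  have e := rel_jMinus_succ h2
  have hz := ent_comp_zero (c := 1) B
  obtain rfl : jPlus k m ∘ₗ A = C := h1
  have e' := ent_jPlus_comp A
  grind [ent_of_row_le, ent_of_col_le]

theorem finrank_hom_M'_E3 : Module.finrank k (homSub
    (LinearMap.id : (Fin 1 → k) →ₗ[k] (Fin 1 → k)) (0 : (Fin 1 → k) →ₗ[k] (Fin 0 → k)) 0
    (jPlus k m) LinearMap.id (jMinus k m)) ≤ 0 := by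
  refine finrank_homSub_le Fin.elim0 fun A B C h1 h2 h3 _ => ?_
  have hz : ∀ i j, ent i j A = 0 := fun i j => by
    rw [← ent_comp_zero B i j, ← h2, LinearMap.id_comp]
  obtain rfl : jPlus k m ∘ₗ A = C := h1
  have e' := ent_jPlus_comp A
  grind [ent_of_row_le, ent_of_col_le]

theorem finrank_hom_M'_E4 : Module.finrank k (homSub
    (LinearMap.id : (Fin 1 → k) →ₗ[k] (Fin 1 → k)) (0 : (Fin 1 → k) →ₗ[k] (Fin 0 → k)) 0
    (piPlus k m) LinearMap.id (piMinus k m)) ≤ 0 := by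
  refine finrank_homSub_le Fin.elim0 fun A B C h1 h2 h3 _ => ?_
  have hz : ∀ i j, ent i j A = 0 := fun i j => by
    rw [← ent_comp_zero B i j, ← h2, LinearMap.id_comp]
  obtain rfl : piPlus k m ∘ₗ A = C := h1
  have e' := fun i j => ent_piPlus_comp A (i := i) j
  grind [ent_of_row_le, ent_of_col_le]

theorem finrank_hom_E1_M' : Module.finrank k (homSub (piPlus k m) (piMinus k m) LinearMap.id
    (LinearMap.id : (Fin 1 → k) →ₗ[k] (Fin 1 → k)) (0 : (Fin 1 → k) →ₗ[k] (Fin 0 → k)) 0) ≤ 0 := by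
  refine finrank_homSub_le Fin.elim0 fun A B C h1 h2 h3 _ => ?_
  have hz : ∀ i j, ent i j C = 0 := fun i j => by
    rw [← ent_zero_comp B i j, h3, LinearMap.comp_id]
  obtain rfl : A = C ∘ₗ piPlus k m := h1
  have e' := ent_comp_piPlus C
  grind [ent_of_row_le, ent_of_col_le]

theorem finrank_hom_E2_M' : Module.finrank k (homSub (jPlus k m) (jMinus k m) LinearMap.id
    (LinearMap.id : (Fin 1 → k) →ₗ[k] (Fin 1 → k)) (0 : (Fin 1 → k) →ₗ[k] (Fin 0 → k)) 0) ≤ 0 := by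
  refine finrank_homSub_le Fin.elim0 fun A B C h1 h2 h3 _ => ?_
  have hz : ∀ i j, ent i j C = 0 := fun i j => by
    rw [← ent_zero_comp B i j, h3, LinearMap.comp_id]
  obtain rfl : A = C ∘ₗ jPlus k m := h1
  have e' := fun i j => ent_comp_jPlus C i (j := j)
  grind [ent_of_row_le, ent_of_col_le]

theorem finrank_hom_E3_M' : Module.finrank k (homSub (jPlus k m) LinearMap.id (jMinus k m)
    (LinearMap.id : (Fin 1 → k) →ₗ[k] (Fin 1 → k)) (0 : (Fin 1 → k) →ₗ[k] (Fin 0 → k)) 0) ≤ 1 := by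
  refine finrank_homSub_le (fun _ => ent 0 0 ∘ₗ LinearMap.snd k _ _ ∘ₗ LinearMap.snd k _ _)
    fun A B C h1 h2 h3 hΦ => ?_
  have hC : ent 0 0 C = 0 := hΦ 0
  have hz := ent_zero_comp (c := 1) B
  rw [h3] at hz
  have e := fun i j => ent_comp_jMinus C i (j := j)
  have hC' : ∀ i j, ent i j C = 0 := by
    intro i j
    cases j <;> grind [ent_of_row_le, ent_of_col_le]
  obtain rfl : A = C ∘ₗ jPlus k m := h1
  have e' := fun i j => ent_comp_jPlus C i (j := j)
  grind [ent_of_row_le, ent_of_col_le]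

theorem finrank_hom_E4_M' : Module.finrank k (homSub (piPlus k m) LinearMap.id (piMinus k m)
    (LinearMap.id : (Fin 1 → k) →ₗ[k] (Fin 1 → k)) (0 : (Fin 1 → k) →ₗ[k] (Fin 0 → k)) 0) ≤ 0 := by
  refine finrank_homSub_le Fin.elim0 fun A B C h1 h2 h3 _ => ?_
  have hz := ent_zero_comp (c := 1) B
  rw [h3] at hz
  have e := ent_comp_piMinus_succ C
  obtain rfl : A = C ∘ₗ piPlus k m := h1
  have e' := ent_comp_piPlus C
  grind [ent_of_row_le, ent_of_col_le]

end SimpleBounds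

theorem finrank_hom_M_M : Module.finrank k (homSub
    (0 : (Fin 0 → k) →ₗ[k] (Fin 0 → k)) (0 : (Fin 0 → k) →ₗ[k] (Fin 1 → k)) 0
    (0 : (Fin 0 → k) →ₗ[k] (Fin 0 → k)) (0 : (Fin 0 → k) →ₗ[k] (Fin 1 → k)) 0) ≤ 1 := by
  refine finrank_homSub_le (fun _ => ent 0 0 ∘ₗ LinearMap.fst k _ _ ∘ₗ LinearMap.snd k _ _)
    fun A B C h1 h2 h3 hΦ => ?_
  have hB : ent 0 0 B = 0 := hΦ 0
  grind [ent_of_row_le, ent_of_col_le]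

theorem finrank_hom_M_M' : Module.finrank k (homSub
    (0 : (Fin 0 → k) →ₗ[k] (Fin 0 → k)) (0 : (Fin 0 → k) →ₗ[k] (Fin 1 → k)) 0
    (LinearMap.id : (Fin 1 → k) →ₗ[k] (Fin 1 → k)) (0 : (Fin 1 → k) →ₗ[k] (Fin 0 → k)) 0) ≤ 0 := by
  refine finrank_homSub_le Fin.elim0 fun A B C h1 h2 h3 _ => ?_
  grind [ent_of_row_le, ent_of_col_le]

theorem finrank_hom_M'_M : Module.finrank k (homSub
    (LinearMap.id : (Fin 1 → k) →ₗ[k] (Fin 1 → k)) (0 : (Fin 1 → k) →ₗ[k] (Fin 0 → k)) 0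
    (0 : (Fin 0 → k) →ₗ[k] (Fin 0 → k)) (0 : (Fin 0 → k) →ₗ[k] (Fin 1 → k)) 0) ≤ 0 := by
  refine finrank_homSub_le Fin.elim0 fun A B C h1 h2 h3 _ => ?_
  grind [ent_of_row_le, ent_of_col_le]

theorem finrank_hom_M'_M' : Module.finrank k (homSub
    (LinearMap.id : (Fin 1 → k) →ₗ[k] (Fin 1 → k)) (0 : (Fin 1 → k) →ₗ[k] (Fin 0 → k)) 0
    (LinearMap.id : (Fin 1 → k) →ₗ[k] (Fin 1 → k)) (0 : (Fin 1 → k) →ₗ[k] (Fin 0 → k)) 0) ≤ 1 := by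
  refine finrank_homSub_le (fun _ => ent 0 0 ∘ₗ LinearMap.fst k _ _)
    fun A B C h1 h2 h3 hΦ => ?_
  have hA : ent 0 0 A = 0 := hΦ 0
  obtain rfl : A = C := h1
  grind [ent_of_row_le, ent_of_col_le]

/-! ### Polynomial families of kernel vectors -/

section PolynomialCurves

variable {k : Type*} [Field k]

/-- Polynomial functions on a field. -/
def IsPoly (F : k → k) : Prop := ∃ p : Polynomial k, ∀ t, F t = p.eval t

namespace IsPoly

theorem const (c : k) : IsPoly fun _ : k => c := ⟨Polynomial.C c, by simp⟩

theorem var : IsPoly fun t : k => t := ⟨Polynomial.X, by simp⟩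

theorem add {F G : k → k} (hF : IsPoly F) (hG : IsPoly G) : IsPoly fun t => F t + G t := by
  obtain ⟨p, hp⟩ := hF
  obtain ⟨q, hq⟩ := hG
  exact ⟨p + q, by simp [hp, hq]⟩

theorem sub {F G : k → k} (hF : IsPoly F) (hG : IsPoly G) : IsPoly fun t => F t - G t := by
  obtain ⟨p, hp⟩ := hF
  obtain ⟨q, hq⟩ := hG
  exact ⟨p - q, by simp [hp, hq]⟩

theorem mul {F G : k → k} (hF : IsPoly F) (hG : IsPoly G) : IsPoly fun t => F t * G t := by
  obtain ⟨p, hp⟩ := hF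
  obtain ⟨q, hq⟩ := hG
  exact ⟨p * q, by simp [hp, hq]⟩

theorem sum {ι : Type*} (s : Finset ι) {F : ι → k → k} (hF : ∀ i, IsPoly (F i)) :
    IsPoly fun t => ∑ i ∈ s, F i t := by
  choose p hp using hF
  exact ⟨∑ i ∈ s, p i, by simp [hp, Polynomial.eval_finsetSum]⟩

theorem det {ι : Type*} [Fintype ι] [DecidableEq ι] {M : k → Matrix ι ι k}
    (hM : ∀ i j, IsPoly fun t => M t i j) : IsPoly fun t => (M t).det := by
  choose p hp using hM
  refine ⟨(Matrix.of p).det, fun t => ?_⟩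
  rw [← Polynomial.coe_evalRingHom, RingHom.map_det]
  refine congrArg Matrix.det (Matrix.ext fun i j => ?_)
  simp [hp]

theorem adjugate {ι : Type*} [Fintype ι] [DecidableEq ι] {M : k → Matrix ι ι k}
    (hM : ∀ i j, IsPoly fun t => M t i j) (i j : ι) : IsPoly fun t => (M t).adjugate i j := by
  simp only [Matrix.adjugate_apply]
  refine det fun i' j' => ?_
  by_cases h : i' = j
  · subst h
    simpa using const _
  · simpa [Matrix.updateRow_ne h] using hM i' j'

theorem finite_zeros {F : k → k} (hF : IsPoly F) {t₀ : k} (h : F t₀ ≠ 0) :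
    {t | F t = 0}.Finite := by
  classical
  obtain ⟨p, hp⟩ := hF
  have hp0 : p ≠ 0 := by
    rintro rfl
    simp [hp] at h
  refine (p.roots.toFinset.finite_toSet).subset fun t ht => ?_
  simpa [hp0, ← hp t] using ht

end IsPoly

/-- A kernel vector of a surjective linear map extends to a polynomial family of kernel vectors
along any pencil through this map. -/
theorem exists_polynomial_kernel {V W : Type*} [AddCommGroup V] [Module k V] [AddCommGroup W]
    [Module k W] [Module.Finite k W] (D₀ D₁ : V →ₗ[k] W) (hD : Function.Surjective D₀) (v₀ : V)
    (hv : D₀ v₀ = 0) :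
    ∃ v : k → V, v 0 = v₀ ∧ (∀ t, (D₀ + t • D₁) (v t) = 0) ∧
      ∀ φ : V →ₗ[k] k, IsPoly fun t => φ (v t) := by
  let b := Module.finBasis k W
  choose s hs using fun j => hD (b j)
  let N : Matrix _ _ k := Matrix.of fun i j => b.repr (D₁ (s j)) i
  let w := fun i => b.repr (D₁ v₀) i
  let M : k → Matrix _ _ k := fun t => 1 + t • N
  have hM : ∀ i j, IsPoly fun t => M t i j := fun i j => by
    simpa [M] using (IsPoly.const _).add (IsPoly.var.mul (IsPoly.const _))
  -- Cramer's rule. In the chosen basis, `D₀ + t • D₁` sends the `s j` to the columns of `M t = 1 +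
  -- t • N` and sends `v₀` to `t • w`. Scaling by the determinant and using the adjugate instead of
  -- the inverse keeps the family polynomial; at `t = 0` it is `v₀`.
  refine ⟨fun t => (M t).det • v₀ - ∑ j, ((M t).adjugate.mulVec (t • w)) j • s j, ?_, ?_, ?_⟩
  · simp [M]
  · intro t
    apply b.repr.injective
    ext i
    have h := congrFun (congrArg (fun A => Matrix.mulVec A (t • w)) (Matrix.mul_adjugate (M t))) i
    simp only [← Matrix.mulVec_mulVec, Matrix.smul_mulVec, Matrix.one_mulVec] at h
    rw [Matrix.mulVec, dotProduct] at h
    have hcol (j) : b.repr ((D₀ + t • D₁) (s j)) i = M t i j := by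
      simp [hs, M, N, Matrix.one_apply, Finsupp.single_apply, eq_comm]
    have h0 : b.repr ((D₀ + t • D₁) v₀) i = (t • w) i := by
      simp [hv, w]
    rw [map_sub, map_smul, map_sum, map_sub, map_smul, map_sum]
    simp only [map_smul, Finsupp.sub_apply, Finsupp.smul_apply, Finsupp.finsetSum_apply, hcol, h0]
    rw [map_zero, Finsupp.zero_apply, sub_eq_zero, ← Pi.smul_apply, ← h]
    exact Finset.sum_congr rfl fun j _ => by rw [smul_eq_mul, mul_comm]
  · intro φ
    simp only [map_sub, map_smul, map_sum, smul_eq_mul, Matrix.mulVec, dotProduct, Pi.smul_apply]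
    exact ((IsPoly.det hM).mul (.const _)).sub (.sum _ fun j => .mul (.sum _ fun i =>
      (IsPoly.adjugate hM j i).mul (IsPoly.var.mul (.const _))) (.const _))

end PolynomialCurves

/-! ### Rigid representations are determined by their dimension vectors -/

section Rigid

variable {k : Type u} [Field k] {α β γ : ℕ}

/-- The linear map measuring the failure of a triple to be a morphism of representations. -/
def defect (f : (Fin α → k) →ₗ[k] (Fin γ → k)) (g : (Fin α → k) →ₗ[k] (Fin β → k))
    (h : (Fin β → k) →ₗ[k] (Fin γ → k)) (f' : (Fin α → k) →ₗ[k] (Fin γ → k))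
    (g' : (Fin α → k) →ₗ[k] (Fin β → k)) (h' : (Fin β → k) →ₗ[k] (Fin γ → k)) :
    (((Fin α → k) →ₗ[k] (Fin α → k)) × ((Fin β → k) →ₗ[k] (Fin β → k)) ×
      ((Fin γ → k) →ₗ[k] (Fin γ → k))) →ₗ[k]
    (((Fin α → k) →ₗ[k] (Fin γ → k)) × ((Fin α → k) →ₗ[k] (Fin β → k)) ×
      ((Fin β → k) →ₗ[k] (Fin γ → k))) where
  toFun x := (f' ∘ₗ x.1 - x.2.2 ∘ₗ f, g' ∘ₗ x.1 - x.2.1 ∘ₗ g, h' ∘ₗ x.2.1 - x.2.2 ∘ₗ h)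
  map_add' x y := by
    simp only [Prod.fst_add, Prod.snd_add, LinearMap.comp_add, LinearMap.add_comp,
      add_sub_add_comm, Prod.mk_add_mk]
  map_smul' c x := by
    simp only [Prod.smul_fst, Prod.smul_snd, LinearMap.comp_smul, LinearMap.smul_comp, smul_sub,
      Prod.smul_mk, RingHom.id_apply]

/-- The derivative of `defect` in the direction of a change of the target. -/
def defectDeriv (f : (Fin α → k) →ₗ[k] (Fin γ → k)) (g : (Fin α → k) →ₗ[k] (Fin β → k))
    (h : (Fin β → k) →ₗ[k] (Fin γ → k)) :
    (((Fin α → k) →ₗ[k] (Fin α → k)) × ((Fin β → k) →ₗ[k] (Fin β → k)) ×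
      ((Fin γ → k) →ₗ[k] (Fin γ → k))) →ₗ[k]
    (((Fin α → k) →ₗ[k] (Fin γ → k)) × ((Fin α → k) →ₗ[k] (Fin β → k)) ×
      ((Fin β → k) →ₗ[k] (Fin γ → k))) where
  toFun x := (f ∘ₗ x.1, g ∘ₗ x.1, h ∘ₗ x.2.1)
  map_add' x y := by simp [LinearMap.comp_add]
  map_smul' c x := by simp [LinearMap.comp_smul]

variable {f : (Fin α → k) →ₗ[k] (Fin γ → k)} {g : (Fin α → k) →ₗ[k] (Fin β → k)}
    {h : (Fin β → k) →ₗ[k] (Fin γ → k)} {f' : (Fin α → k) →ₗ[k] (Fin γ → k)}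
    {g' : (Fin α → k) →ₗ[k] (Fin β → k)} {h' : (Fin β → k) →ₗ[k] (Fin γ → k)}

theorem ker_defect : LinearMap.ker (defect f g h f' g' h') = homSub f g h f' g' h' := by
  ext x
  simp [defect, homSub, sub_eq_zero]

theorem euler_of_hasDims {X Y : Rep k} {n e : ℕ} (H : HasDims k X Y n e) :
    Module.finrank k (X ⟶ Y) = n ∧ e + (Module.finrank k (X.obj pb) * Module.finrank k (Y.obj pb) +
      Module.finrank k (X.obj pm) * Module.finrank k (Y.obj pm) +
       Module.finrank k (X.obj pe) * Module.finrank k (Y.obj pe)) =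
    n + (Module.finrank k (X.obj pb) * Module.finrank k (Y.obj pm) +
      Module.finrank k (X.obj pb) * Module.finrank k (Y.obj pe) +
       Module.finrank k (X.obj pm) * Module.finrank k (Y.obj pe)) := by
  have h1 : Module.finrank k (X ⟶ Y) = n := Module.finrank_eq_of_rank_eq H.1
  have h2 : Module.finrank k (Abelian.Ext X Y 1) = e := Module.finrank_eq_of_rank_eq H.2
  have := finrank_ext_one_add X Y
  rw [h1, h2] at this
  exact ⟨h1, this⟩

/-- The kernel is the endomorphism space, of dimension 1, and the Euler form equals 1, so the range
has the dimension of the codomain. -/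
theorem defect_surjective (H : HasDims k (rep k f g h) (rep k f g h) 1 0) :
    Function.Surjective (defect f g h f g h) := by
  obtain ⟨h1, h2⟩ := euler_of_hasDims H
  obtain ⟨d1, d2, d3⟩ := finrank_rep_obj f g h
  rw [finrank_rep_hom, ← ker_defect] at h1
  rw [d1, d2, d3] at h2
  have h3 := LinearMap.finrank_range_add_finrank_ker (defect f g h f g h)
  rw [← LinearMap.range_eq_top]
  apply Submodule.eq_top_of_finrank_eq
  simp only [Module.finrank_prod, Module.finrank_linearMap, Module.finrank_fin_fun] at h3 ⊢
  omega

/-- An isomorphism between explicit representations. -/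
theorem nonempty_iso_rep (A : (Fin α → k) →ₗ[k] (Fin α → k)) (B : (Fin β → k) →ₗ[k] (Fin β → k))
    (C : (Fin γ → k) →ₗ[k] (Fin γ → k)) (hA : LinearMap.det A ≠ 0) (hB : LinearMap.det B ≠ 0)
    (hC : LinearMap.det C ≠ 0) (hm : (A, B, C) ∈ homSub f g h f' g' h') :
    Nonempty (rep k f g h ≅ rep k f' g' h') := by
  let eA := LinearEquiv.ofIsUnitDet (f := A) (v := Pi.basisFun k _) (v' := Pi.basisFun k _)
    (by simpa [LinearMap.det_toMatrix] using hA)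
  let eB := LinearEquiv.ofIsUnitDet (f := B) (v := Pi.basisFun k _) (v' := Pi.basisFun k _)
    (by simpa [LinearMap.det_toMatrix] using hB)
  let eC := LinearEquiv.ofIsUnitDet (f := C) (v := Pi.basisFun k _) (v' := Pi.basisFun k _)
    (by simpa [LinearMap.det_toMatrix] using hC)
  obtain ⟨h1, h2, h3⟩ := hm
  refine ⟨isoMk (X := ofMaps f g h) (Y := ofMaps f' g' h') eA eB eC ?_ ?_ ?_⟩
  · rw [be_ofMaps, be_ofMaps]
    exact h1
  · rw [bm_ofMaps, bm_ofMaps]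
    exact h2
  · rw [me_ofMaps, me_ofMaps]
    exact h3

/-- The orbit of a rigid representation contains almost all points of any line through it. -/
theorem finite_not_iso (H : HasDims k (rep k f g h) (rep k f g h) 1 0)
    (u : (Fin α → k) →ₗ[k] (Fin γ → k))
    (v : (Fin α → k) →ₗ[k] (Fin β → k)) (w : (Fin β → k) →ₗ[k] (Fin γ → k)) :
    {t : k | ¬ Nonempty (rep k f g h ≅ rep k (f + t • u) (g + t • v) (h + t • w))}.Finite := by
  -- The source stays fixed and the target moves along the line, so the defect is affine in `t` and
  -- the identity is a kernel vector at `t = 0`.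
  obtain ⟨x, hx0, hx, hpoly⟩ := exists_polynomial_kernel (defect f g h f g h) (defectDeriv u v w)
    (defect_surjective H) (LinearMap.id, LinearMap.id, LinearMap.id) (by simp [defect])
  have key {ι : ℕ} (p : _ →ₗ[k] ((Fin ι → k) →ₗ[k] (Fin ι → k)))
    (hp : p (LinearMap.id, LinearMap.id, LinearMap.id) = LinearMap.id) :
      {t | LinearMap.det (p (x t)) = 0}.Finite := by
    refine IsPoly.finite_zeros (t₀ := 0) ?_ ?_
    · simp only [← LinearMap.det_toMatrix']
      refine IsPoly.det fun i j => ?_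
      exact hpoly (LinearMap.proj i ∘ₗ LinearMap.applyₗ (Pi.single j 1) ∘ₗ p)
    · simp [hx0, hp]
  refine (((key (LinearMap.fst k _ _) rfl).union
    (key (LinearMap.fst k _ _ ∘ₗ LinearMap.snd k _ _) rfl)).union
    (key (LinearMap.snd k _ _ ∘ₗ LinearMap.snd k _ _) rfl)).subset fun t ht => ?_
  by_contra hc
  simp only [Set.mem_union, Set.mem_ofPred_eq, not_or] at hc
  refine ht (nonempty_iso_rep _ _ _ hc.1.1 hc.1.2 hc.2 ?_)
  rw [← ker_defect]
  refine Eq.trans ?_ (hx t)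
  simp only [defect, defectDeriv, LinearMap.coe_mk, AddHom.coe_mk, LinearMap.add_apply,
    LinearMap.smul_apply, LinearMap.add_comp, LinearMap.smul_comp, Prod.smul_mk, Prod.mk_add_mk,
    LinearMap.comp_apply, LinearMap.fst_apply, LinearMap.snd_apply]
  simp only [sub_eq_add_neg, add_right_comm]

/-- Rigid representations are determined by their dimension vectors. -/
theorem iso_of_rigid [Infinite k] (H : HasDims k (rep k f g h) (rep k f g h) 1 0)
    (H' : HasDims k (rep k f' g' h') (rep k f' g' h') 1 0) :
    Nonempty (rep k f g h ≅ rep k f' g' h') := by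
  -- The same line is parametrised from both ends: the point at `t` seen from the first
  -- representation is the point at `1 - t` seen from the second.
  have h1 := finite_not_iso H (f' - f) (g' - g) (h' - h)
  have h2 := (finite_not_iso H' (f - f') (g - g') (h - h')).preimage
    (f := fun t : k => 1 - t) (by intro x _ y _ hxy; simpa using hxy)
  obtain ⟨t, ht⟩ := (h1.union h2).exists_notMem
  simp only [Set.mem_union, Set.mem_ofPred_eq, Set.mem_preimage, not_or, not_not] at ht
  obtain ⟨⟨i⟩, ⟨j⟩⟩ := ht
  have e1 : f' + (1 - t) • (f - f') = f + t • (f' - f) := by module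
  have e2 : g' + (1 - t) • (g - g') = g + t • (g' - g) := by module
  have e3 : h' + (1 - t) • (h - h') = h + t • (h' - h) := by module
  rw [e1, e2, e3] at j
  exact ⟨i ≪≫ j.symm⟩

/-- An endomorphism of a representation with one-dimensional endomorphism space is scalar. -/
theorem eq_smul_of_finrank_eq_one (H : Module.finrank k (homSub f g h f g h) = 1)
    {A : (Fin α → k) →ₗ[k] (Fin α → k)} {B : (Fin β → k) →ₗ[k] (Fin β → k)}
    {C : (Fin γ → k) →ₗ[k] (Fin γ → k)} (hf : f ∘ₗ A = C ∘ₗ f) (hg : g ∘ₗ A = B ∘ₗ g)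
    (hh : h ∘ₗ B = C ∘ₗ h) :
    ∃ c : k, A = c • LinearMap.id ∧ B = c • LinearMap.id ∧ C = c • LinearMap.id := by
  let one : homSub f g h f g h := ⟨(LinearMap.id, LinearMap.id, LinearMap.id), rfl, rfl, rfl⟩
  have hone : one ≠ 0 := by
    intro h0
    have h0' := congrArg Subtype.val h0
    have hA : (LinearMap.id : (Fin α → k) →ₗ[k] _) = 0 := congrArg (fun t => t.1) h0'
    have hB : (LinearMap.id : (Fin β → k) →ₗ[k] _) = 0 := congrArg (fun t => t.2.1) h0'
    have hC : (LinearMap.id : (Fin γ → k) →ₗ[k] _) = 0 := congrArg (fun t => t.2.2) h0'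
    have : Subsingleton (homSub f g h f g h) := by
      refine subsingleton_of_forall_eq 0 fun x => Subtype.ext (Prod.ext ?_ (Prod.ext ?_ ?_))
      · rw [← LinearMap.id_comp x.1.1, hA, LinearMap.zero_comp]; rfl
      · rw [← LinearMap.id_comp x.1.2.1, hB, LinearMap.zero_comp]; rfl
      · rw [← LinearMap.id_comp x.1.2.2, hC, LinearMap.zero_comp]; rfl
    rw [Module.finrank_zero_of_subsingleton] at H
    omega
  obtain ⟨c, hc⟩ := (finrank_eq_one_iff_of_nonzero' one hone).1 H ⟨(A, B, C), hf, hg, hh⟩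
  have hc' := congrArg Subtype.val hc
  exact ⟨c, (congrArg (fun t => t.1) hc').symm, (congrArg (fun t => t.2.1) hc').symm,
    (congrArg (fun t => t.2.2) hc').symm⟩

end Rigid

/-! ### Which dimension vectors occur -/

section Exclusion

variable {k : Type u} [Field k] {n : ℕ}

/-- Since `h` is not injective and `g` is not surjective, a nonzero rank one map at `mid` that kills
the image of `g` and lands in the kernel of `h` is an endomorphism. It is zero at `b`, a nonzero
space, so it is not scalar. -/
theorem not_finrank_eq_one_of_mid {f : (Fin (n + 1) → k) →ₗ[k] (Fin (n + 1) → k)}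
    {g : (Fin (n + 1) → k) →ₗ[k] (Fin (n + 2) → k)}
    {h : (Fin (n + 2) → k) →ₗ[k] (Fin (n + 1) → k)} :
    Module.finrank k (homSub f g h f g h) ≠ 1 := by
  intro H
  obtain ⟨v, hv, hv0⟩ := Submodule.exists_mem_ne_zero_of_ne_bot
    (LinearMap.ker_ne_bot_of_finrank_lt (f := h) (by simp))
  obtain ⟨φ, hφ, hφg⟩ := Submodule.exists_le_ker_of_lt_top (LinearMap.range g)
    (Submodule.lt_top_of_finrank_lt_finrank (by
      have := LinearMap.finrank_range_le g
      simp at this ⊢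
      omega))
  rw [LinearMap.range_le_ker_iff] at hφg
  obtain ⟨c, hA, hB, hC⟩ := eq_smul_of_finrank_eq_one H (A := 0) (B := φ.smulRight v) (C := 0)
    (by simp)
    (by
      rw [LinearMap.comp_zero]
      refine LinearMap.ext fun x => ?_
      have : φ (g x) = 0 := LinearMap.congr_fun hφg x
      simp [this])
    (by
      rw [LinearMap.zero_comp]
      refine LinearMap.ext fun x => ?_
      simp [LinearMap.mem_ker.1 hv])
  have hc : c = 0 := by simpa using (congrFun (LinearMap.congr_fun hA fun _ => 1) 0).symm
  rw [hc, zero_smul] at hB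
  refine hφ (LinearMap.ext fun x => ?_)
  simpa [hv0] using LinearMap.congr_fun hB x

/-- An endomorphism that is zero at `mid`, a nonzero space, can be scalar only if it is zero. Take
`v ≠ 0` in the kernel of `g`. If `f v = 0`, a rank one map onto the line of `v` at `b` works alone.
Otherwise it is paired with a rank one map onto the line of `f v` at `e`, built from a functional
that kills the image of `h`. -/
theorem not_finrank_eq_one_of_be {f : (Fin (n + 2) → k) →ₗ[k] (Fin (n + 2) → k)}
    {g : (Fin (n + 2) → k) →ₗ[k] (Fin (n + 1) → k)}
    {h : (Fin (n + 1) → k) →ₗ[k] (Fin (n + 2) → k)} :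
    Module.finrank k (homSub f g h f g h) ≠ 1 := by
  intro H
  obtain ⟨v, hv, hv0⟩ := Submodule.exists_mem_ne_zero_of_ne_bot
    (LinearMap.ker_ne_bot_of_finrank_lt (f := g) (by simp))
  rw [LinearMap.mem_ker] at hv
  have scalar {A C} (hf : f ∘ₗ A = C ∘ₗ f) (hg : g ∘ₗ A = 0) (hh : C ∘ₗ h = 0) :
      A = 0 ∧ C = 0 := by
    obtain ⟨c, hA, hB, hC⟩ := eq_smul_of_finrank_eq_one H (B := 0) hf
      (by rw [hg, LinearMap.zero_comp]) (by rw [hh, LinearMap.comp_zero])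
    have hc : c = 0 := by simpa using (congrFun (LinearMap.congr_fun hB fun _ => 1) 0).symm
    rw [hc, zero_smul] at hA hC
    exact ⟨hA, hC⟩
  by_cases hfv : f v = 0
  · obtain ⟨hA, -⟩ := scalar (A := (LinearMap.proj 0).smulRight v) (C := 0)
      (by refine LinearMap.ext fun x => ?_; simp [hfv])
      (by refine LinearMap.ext fun x => ?_; simp [hv]) (LinearMap.zero_comp _)
    exact hv0 (by simpa using LinearMap.congr_fun hA fun _ => 1)
  · obtain ⟨φ, hφ, hφh⟩ := Submodule.exists_le_ker_of_lt_top (LinearMap.range h)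
      (Submodule.lt_top_of_finrank_lt_finrank (by
        have := LinearMap.finrank_range_le h
        simp at this ⊢
        omega))
    rw [LinearMap.range_le_ker_iff] at hφh
    obtain ⟨-, hC⟩ := scalar (A := (φ ∘ₗ f).smulRight v) (C := φ.smulRight (f v))
      (by refine LinearMap.ext fun x => ?_; simp) (by refine LinearMap.ext fun x => ?_; simp [hv])
      (by
        refine LinearMap.ext fun x => ?_
        have : φ (h x) = 0 := LinearMap.congr_fun hφh x
        simp [this])
    refine hφ (LinearMap.ext fun x => ?_)
    simpa [hfv] using LinearMap.congr_fun hC x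

theorem dimension_cases {α β γ : ℕ}
    (h : α * α + β * β + γ * γ = 1 + (α * β + α * γ + β * γ)) :
    ∃ m, (α = m + 1 ∧ β = m ∧ γ = m) ∨ (α = m ∧ β = m + 1 ∧ γ = m + 1) ∨
      (α = m ∧ β = m ∧ γ = m + 1) ∨ (α = m + 1 ∧ β = m + 1 ∧ γ = m) ∨
      (α = m ∧ β = m + 1 ∧ γ = m) ∨ (α = m + 1 ∧ β = m ∧ γ = m + 1) := by
  zify at h
  obtain ⟨x, hx⟩ : ∃ x : ℤ, x = α - β := ⟨_, rfl⟩
  obtain ⟨y, hy⟩ : ∃ y : ℤ, y = β - γ := ⟨_, rfl⟩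
  have hα : (α : ℤ) = β + x := by omega
  have hγ : (γ : ℤ) = β - y := by omega
  rw [hα, hγ] at h
  have hq : x * x + x * y + y * y = 1 := by linarith
  -- Completing the square: four times the form is `3x² + (2y + x)²`, so `3x² ≤ 4`, and likewise for
  -- `y`.
  have hx1 : -1 ≤ x := by nlinarith [sq_nonneg (2 * y + x)]
  have hx2 : x ≤ 1 := by nlinarith [sq_nonneg (2 * y + x)]
  have hy1 : -1 ≤ y := by nlinarith [sq_nonneg (2 * x + y)]
  have hy2 : y ≤ 1 := by nlinarith [sq_nonneg (2 * x + y)]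
  refine ⟨min α (min β γ), ?_⟩
  interval_cases x <;> interval_cases y <;> omega

end Exclusion

/-! ### Coordinates and invariance under isomorphism -/

section Transport

variable {k : Type u} [Field k]

theorem exists_iso_rep (X : Rep k) : ∃ (α β γ : ℕ) (f : (Fin α → k) →ₗ[k] (Fin γ → k))
    (g : (Fin α → k) →ₗ[k] (Fin β → k)) (h : (Fin β → k) →ₗ[k] (Fin γ → k)),
    Nonempty (X ≅ rep k f g h) := by
  let a := (Module.finBasis k (X.obj pb)).equivFun
  let b := (Module.finBasis k (X.obj pm)).equivFun
  let c := (Module.finBasis k (X.obj pe)).equivFun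
  refine ⟨_, _, _, c.toLinearMap ∘ₗ be X ∘ₗ a.symm.toLinearMap,
    b.toLinearMap ∘ₗ bm X ∘ₗ a.symm.toLinearMap, c.toLinearMap ∘ₗ me X ∘ₗ b.symm.toLinearMap,
    ⟨isoMk (Y := ofMaps _ _ _) a b c ?_ ?_ ?_⟩⟩
  · rw [be_ofMaps]
    exact LinearMap.ext fun x => congrArg (fun y => c (be X y)) (a.symm_apply_apply x)
  · rw [bm_ofMaps]
    exact LinearMap.ext fun x => congrArg (fun y => b (bm X y)) (a.symm_apply_apply x)
  · rw [me_ofMaps]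
    exact LinearMap.ext fun x => congrArg (fun y => c (me X y)) (b.symm_apply_apply x)

theorem finrank_obj_eq_of_iso {X Y : Rep k} (i : X ≅ Y) (v : Paths Vertex) :
    Module.finrank k (X.obj v) = Module.finrank k (Y.obj v) :=
  (FGModuleCat.isoToLinearEquiv (i.app v)).finrank_eq

/-- It suffices to transport `hom` and the dimension vectors, as these determine `hom¹` by the Euler
form. -/
theorem HasDims.of_iso {X Y X' Y' : Rep k} {n e : ℕ} (H : HasDims k X Y n e) (i : X ≅ X')
    (j : Y ≅ Y') : HasDims k X' Y' n e := by
  obtain ⟨h1, h2⟩ := euler_of_hasDims H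
  apply hasDims_of_finrank
  · rw [← h1]
    exact (Linear.homCongr k i j).symm.finrank_eq
  · simpa only [finrank_obj_eq_of_iso i, finrank_obj_eq_of_iso j] using h2

end Transport

variable (k : Type u) [Field k]

/-! ### The table and the classification -/

section Table

/-- Replaces the truncated subtractions in the table by a single parameter `d`, after which the
Euler form identities are polynomial. -/
theorem tsub_cases (m n : ℕ) : (∃ d, m = n + d ∧ m - n = d ∧ n - m = 0 ∧ m + 1 - n = d + 1 ∧
      n - m - 1 = 0) ∨
    (∃ d, n = m + d + 1 ∧ m - n = 0 ∧ n - m = d + 1 ∧ m + 1 - n = 0 ∧ n - m - 1 = d) := by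
  rcases le_or_gt n m with h | h
  · exact Or.inl ⟨m - n, by omega⟩
  · exact Or.inr ⟨n - m - 1, by omega⟩

variable (m n : ℕ)

theorem hasDims_E1_E1 : HasDims k (E1 k m) (E1 k n) (m + 1 - n) (n - m - 1) := by
  refine hasDims_rep (finrank_hom_E1_E1 m n) ?_ (by omega)
  rcases tsub_cases m n with ⟨d, h1, h2, h3, h4, h5⟩ | ⟨d, h1, h2, h3, h4, h5⟩ <;>
    simp only [h4, h5] <;> subst h1 <;> ring

theorem hasDims_E4_E4 : HasDims k (E4 k m) (E4 k n) (m + 1 - n) (n - m - 1) := by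
  refine hasDims_rep (finrank_hom_E4_E4 m n) ?_ (by omega)
  rcases tsub_cases m n with ⟨d, h1, h2, h3, h4, h5⟩ | ⟨d, h1, h2, h3, h4, h5⟩ <;>
    simp only [h4, h5] <;> subst h1 <;> ring

theorem hasDims_E4_E1 : HasDims k (E4 k m) (E1 k n) (m + 1 - n) (n - m - 1) := by
  refine hasDims_rep (finrank_hom_E4_E1 m n) ?_ (by omega)
  rcases tsub_cases m n with ⟨d, h1, h2, h3, h4, h5⟩ | ⟨d, h1, h2, h3, h4, h5⟩ <;>
    simp only [h4, h5] <;> subst h1 <;> ring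

theorem hasDims_E1_E4 : HasDims k (E1 k m) (E4 k n) (m - n) (n - m) := by
  refine hasDims_rep (finrank_hom_E1_E4 m n) ?_ (by omega)
  rcases tsub_cases m n with ⟨d, h1, h2, h3, h4, h5⟩ | ⟨d, h1, h2, h3, h4, h5⟩ <;>
    simp only [h2, h3] <;> subst h1 <;> ring

theorem hasDims_E2_E2 : HasDims k (E2 k m) (E2 k n) (n + 1 - m) (m - n - 1) := by
  refine hasDims_rep (finrank_hom_E2_E2 m n) ?_ (by omega)
  rcases tsub_cases n m with ⟨d, h1, h2, h3, h4, h5⟩ | ⟨d, h1, h2, h3, h4, h5⟩ <;>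
    simp only [h4, h5] <;> subst h1 <;> ring

theorem hasDims_E3_E3 : HasDims k (E3 k m) (E3 k n) (n + 1 - m) (m - n - 1) := by
  refine hasDims_rep (finrank_hom_E3_E3 m n) ?_ (by omega)
  rcases tsub_cases n m with ⟨d, h1, h2, h3, h4, h5⟩ | ⟨d, h1, h2, h3, h4, h5⟩ <;>
    simp only [h4, h5] <;> subst h1 <;> ring

theorem hasDims_E3_E2 : HasDims k (E3 k m) (E2 k n) (n + 1 - m) (m - n - 1) := by
  refine hasDims_rep (finrank_hom_E3_E2 m n) ?_ (by omega)
  rcases tsub_cases n m with ⟨d, h1, h2, h3, h4, h5⟩ | ⟨d, h1, h2, h3, h4, h5⟩ <;>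
    simp only [h4, h5] <;> subst h1 <;> ring

theorem hasDims_E2_E3 : HasDims k (E2 k m) (E3 k n) (n - m) (m - n) := by
  refine hasDims_rep (finrank_hom_E2_E3 m n) ?_ (by omega)
  rcases tsub_cases n m with ⟨d, h1, h2, h3, h4, h5⟩ | ⟨d, h1, h2, h3, h4, h5⟩ <;>
    simp only [h2, h3] <;> subst h1 <;> ring

theorem hasDims_E2_E1 : HasDims k (E2 k m) (E1 k n) (n + m) (0) := by
  exact hasDims_rep (finrank_hom_E2_E1 m n) (by ring) (by simp)

theorem hasDims_E3_E1 : HasDims k (E3 k m) (E1 k n) (n + m) (0) := by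
  exact hasDims_rep (finrank_hom_E3_E1 m n) (by ring) (by simp)

theorem hasDims_E3_E4 : HasDims k (E3 k m) (E4 k n) (n + m) (0) := by
  exact hasDims_rep (finrank_hom_E3_E4 m n) (by ring) (by simp)

theorem hasDims_E2_E4 : HasDims k (E2 k m) (E4 k n) (1 + n + m) (0) := by
  exact hasDims_rep (finrank_hom_E2_E4 m n) (by ring) (by simp)

theorem hasDims_E1_E2 : HasDims k (E1 k m) (E2 k n) (0) (n + m + 2) := by
  exact hasDims_rep (finrank_hom_E1_E2 m n) (by ring) (by simp)

theorem hasDims_E1_E3 : HasDims k (E1 k m) (E3 k n) (0) (n + m + 1) := by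
  exact hasDims_rep (finrank_hom_E1_E3 m n) (by ring) (by simp)

theorem hasDims_E4_E2 : HasDims k (E4 k m) (E2 k n) (0) (n + m + 2) := by
  exact hasDims_rep (finrank_hom_E4_E2 m n) (by ring) (by simp)

theorem hasDims_E4_E3 : HasDims k (E4 k m) (E3 k n) (0) (n + m + 2) := by
  exact hasDims_rep (finrank_hom_E4_E3 m n) (by ring) (by simp)

theorem hasDims_E1_M : HasDims k (E1 k m) (M k) 0 1 :=
  hasDims_rep (finrank_hom_E1_M m) (by ring) (by simp)

theorem hasDims_E2_M : HasDims k (E2 k m) (M k) 1 0 :=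
  hasDims_rep (finrank_hom_E2_M m) (by ring) (by simp)

theorem hasDims_E3_M : HasDims k (E3 k m) (M k) 0 0 :=
  hasDims_rep (finrank_hom_E3_M m) (by ring) (by simp)

theorem hasDims_E4_M : HasDims k (E4 k m) (M k) 0 0 :=
  hasDims_rep (finrank_hom_E4_M m) (by ring) (by simp)

theorem hasDims_M_E1 : HasDims k (M k) (E1 k m) 0 0 :=
  hasDims_rep (finrank_hom_M_E1 m) (by ring) (by simp)

theorem hasDims_M_E2 : HasDims k (M k) (E2 k m) 0 0 :=
  hasDims_rep (finrank_hom_M_E2 m) (by ring) (by simp)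

theorem hasDims_M_E3 : HasDims k (M k) (E3 k m) 0 1 :=
  hasDims_rep (finrank_hom_M_E3 m) (by ring) (by simp)

theorem hasDims_M_E4 : HasDims k (M k) (E4 k m) 1 0 :=
  hasDims_rep (finrank_hom_M_E4 m) (by ring) (by simp)

theorem hasDims_M'_E1 : HasDims k (M' k) (E1 k m) 1 0 :=
  hasDims_rep (finrank_hom_M'_E1 m) (by ring) (by simp)

theorem hasDims_M'_E2 : HasDims k (M' k) (E2 k m) 0 1 :=
  hasDims_rep (finrank_hom_M'_E2 m) (by ring) (by simp)

theorem hasDims_M'_E3 : HasDims k (M' k) (E3 k m) 0 0 :=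
  hasDims_rep (finrank_hom_M'_E3 m) (by ring) (by simp)

theorem hasDims_M'_E4 : HasDims k (M' k) (E4 k m) 0 0 :=
  hasDims_rep (finrank_hom_M'_E4 m) (by ring) (by simp)

theorem hasDims_E1_M' : HasDims k (E1 k m) (M' k) 0 0 :=
  hasDims_rep (finrank_hom_E1_M' m) (by ring) (by simp)

theorem hasDims_E2_M' : HasDims k (E2 k m) (M' k) 0 0 :=
  hasDims_rep (finrank_hom_E2_M' m) (by ring) (by simp)

theorem hasDims_E3_M' : HasDims k (E3 k m) (M' k) 1 0 :=
  hasDims_rep (finrank_hom_E3_M' m) (by ring) (by simp)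

theorem hasDims_E4_M' : HasDims k (E4 k m) (M' k) 0 1 :=
  hasDims_rep (finrank_hom_E4_M' m) (by ring) (by simp)

end Table

theorem hasDims_M_M : HasDims k (M k) (M k) 1 0 :=
  hasDims_rep finrank_hom_M_M (by norm_num) (by simp)

theorem hasDims_M_M' : HasDims k (M k) (M' k) 0 1 :=
  hasDims_rep finrank_hom_M_M' (by norm_num) (by simp)

theorem hasDims_M'_M : HasDims k (M' k) (M k) 0 1 :=
  hasDims_rep finrank_hom_M'_M (by norm_num) (by simp)

theorem hasDims_M'_M' : HasDims k (M' k) (M' k) 1 0 :=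
  hasDims_rep finrank_hom_M'_M' (by norm_num) (by simp)

theorem hasDims_E1 (m : ℕ) : HasDims k (E1 k m) (E1 k m) 1 0 := by
  simpa using hasDims_E1_E1 k m m

theorem hasDims_E2 (m : ℕ) : HasDims k (E2 k m) (E2 k m) 1 0 := by
  simpa using hasDims_E2_E2 k m m

theorem hasDims_E3 (m : ℕ) : HasDims k (E3 k m) (E3 k m) 1 0 := by
  simpa using hasDims_E3_E3 k m m

theorem hasDims_E4 (m : ℕ) : HasDims k (E4 k m) (E4 k m) 1 0 := by
  simpa using hasDims_E4_E4 k m m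

/-- The list of exceptional objects. -/
def IsListed (X : Rep k) : Prop :=
  (∃ m : ℕ, Nonempty (X ≅ E1 k m)) ∨ (∃ m : ℕ, Nonempty (X ≅ E2 k m)) ∨
    (∃ m : ℕ, Nonempty (X ≅ E3 k m)) ∨ (∃ m : ℕ, Nonempty (X ≅ E4 k m)) ∨
    Nonempty (X ≅ M k) ∨ Nonempty (X ≅ M' k)

variable {k}

theorem IsListed.hasDims {X : Rep k} (hX : IsListed k X) : HasDims k X X 1 0 := by
  rcases hX with ⟨m, ⟨i⟩⟩ | ⟨m, ⟨i⟩⟩ | ⟨m, ⟨i⟩⟩ | ⟨m, ⟨i⟩⟩ | ⟨⟨i⟩⟩ | ⟨⟨i⟩⟩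
  · exact (hasDims_E1 k m).of_iso i.symm i.symm
  · exact (hasDims_E2 k m).of_iso i.symm i.symm
  · exact (hasDims_E3 k m).of_iso i.symm i.symm
  · exact (hasDims_E4 k m).of_iso i.symm i.symm
  · exact (hasDims_M_M k).of_iso i.symm i.symm
  · exact (hasDims_M'_M' k).of_iso i.symm i.symm

/-- The dimension vector falls into one of six families. Where a listed object has that dimension
vector, rigidity gives the isomorphism; the remaining ones contradict one-dimensionality of the
endomorphism space. -/
theorem isListed_of_hasDims [Infinite k] {X : Rep k} (H : HasDims k X X 1 0) : IsListed k X := by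
  obtain ⟨α, β, γ, f, g, h, ⟨i⟩⟩ := exists_iso_rep X
  have H' := H.of_iso i i
  obtain ⟨h1, h2⟩ := euler_of_hasDims H'
  obtain ⟨d1, d2, d3⟩ := finrank_rep_obj f g h
  rw [d1, d2, d3, zero_add] at h2
  rw [finrank_rep_hom] at h1
  obtain ⟨m, ⟨rfl, rfl, rfl⟩ | ⟨rfl, rfl, rfl⟩ | ⟨rfl, rfl, rfl⟩ | ⟨rfl, rfl, rfl⟩ |
    ⟨rfl, rfl, rfl⟩ | ⟨rfl, rfl, rfl⟩⟩ := dimension_cases h2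
  · obtain ⟨j⟩ := iso_of_rigid H' (hasDims_E1 k _)
    exact Or.inl ⟨_, ⟨i ≪≫ j⟩⟩
  · obtain ⟨j⟩ := iso_of_rigid H' (hasDims_E2 k _)
    exact Or.inr (Or.inl ⟨_, ⟨i ≪≫ j⟩⟩)
  · obtain ⟨j⟩ := iso_of_rigid H' (hasDims_E3 k _)
    exact Or.inr (Or.inr (Or.inl ⟨_, ⟨i ≪≫ j⟩⟩))
  · obtain ⟨j⟩ := iso_of_rigid H' (hasDims_E4 k _)
    exact Or.inr (Or.inr (Or.inr (Or.inl ⟨_, ⟨i ≪≫ j⟩⟩)))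
  · rcases γ with _ | m
    · obtain ⟨j⟩ := iso_of_rigid H' (hasDims_M_M k)
      exact Or.inr (Or.inr (Or.inr (Or.inr (Or.inl ⟨i ≪≫ j⟩))))
    · exact (not_finrank_eq_one_of_mid h1).elim
  · rcases β with _ | m
    · obtain ⟨j⟩ := iso_of_rigid H' (hasDims_M'_M' k)
      exact Or.inr (Or.inr (Or.inr (Or.inr (Or.inr ⟨i ≪≫ j⟩))))
    · exact (not_finrank_eq_one_of_be h1).elim

theorem isExceptional_iff_isListed [Infinite k] (X : Rep k) :
    IsExceptional k X ↔ IsListed k X :=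
  (isExceptional_iff X).trans ⟨isListed_of_hasDims, IsListed.hasDims⟩

theorem HasDims.congr {X Y : Rep k} {n e n' e' : ℕ} (H : HasDims k X Y n e) (hn : n = n')
    (he : e = e') : HasDims k X Y n' e' :=
  hn ▸ he ▸ H

end

end ReprQ1

theorem mainTheorem6 (k : Type u) [Field k] [IsAlgClosed k] :
    -- The exceptional objects are, up to isomorphism, exactly the following ones.
    (∀ X : ReprQ1.Rep k, ReprQ1.IsExceptional k X ↔
      ((∃ m : ℕ, Nonempty (X ≅ ReprQ1.E1 k m)) ∨ (∃ m : ℕ, Nonempty (X ≅ ReprQ1.E2 k m)) ∨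
        (∃ m : ℕ, Nonempty (X ≅ ReprQ1.E3 k m)) ∨ (∃ m : ℕ, Nonempty (X ≅ ReprQ1.E4 k m)) ∨
        Nonempty (X ≅ ReprQ1.M k) ∨ Nonempty (X ≅ ReprQ1.M' k))) ∧
    -- The pairs of isomorphic exceptional objects.
    (∀ X Y : ReprQ1.Rep k, ReprQ1.IsExceptional k X → Nonempty (X ≅ Y) →
      ReprQ1.HasDims k X Y 1 0) ∧
    -- The table.
    (∀ m n : ℕ, m < n →
      ReprQ1.HasDims k (ReprQ1.E1 k m) (ReprQ1.E1 k n) 0 (n - m - 1) ∧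
      ReprQ1.HasDims k (ReprQ1.E1 k n) (ReprQ1.E1 k m) (1 + n - m) 0) ∧
    (∀ m n : ℕ, n < m →
      ReprQ1.HasDims k (ReprQ1.E2 k m) (ReprQ1.E2 k n) 0 (m - n - 1) ∧
      ReprQ1.HasDims k (ReprQ1.E2 k n) (ReprQ1.E2 k m) (1 + m - n) 0) ∧
    (∀ m n : ℕ, n < m →
      ReprQ1.HasDims k (ReprQ1.E3 k m) (ReprQ1.E3 k n) 0 (m - n - 1) ∧
      ReprQ1.HasDims k (ReprQ1.E3 k n) (ReprQ1.E3 k m) (1 + m - n) 0) ∧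
    (∀ m n : ℕ, m < n →
      ReprQ1.HasDims k (ReprQ1.E4 k m) (ReprQ1.E4 k n) 0 (n - m - 1) ∧
      ReprQ1.HasDims k (ReprQ1.E4 k n) (ReprQ1.E4 k m) (1 + n - m) 0) ∧
    (∀ m n : ℕ,
      ReprQ1.HasDims k (ReprQ1.E1 k m) (ReprQ1.E2 k n) 0 (n + m + 2) ∧
      ReprQ1.HasDims k (ReprQ1.E2 k n) (ReprQ1.E1 k m) (n + m) 0) ∧
    (∀ m n : ℕ,
      ReprQ1.HasDims k (ReprQ1.E1 k m) (ReprQ1.E3 k n) 0 (n + m + 1) ∧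
      ReprQ1.HasDims k (ReprQ1.E3 k n) (ReprQ1.E1 k m) (n + m) 0) ∧
    (∀ m n : ℕ, m ≤ n →
      ReprQ1.HasDims k (ReprQ1.E1 k m) (ReprQ1.E4 k n) 0 (n - m) ∧
      ReprQ1.HasDims k (ReprQ1.E4 k n) (ReprQ1.E1 k m) (1 + n - m) 0) ∧
    (∀ m n : ℕ, n < m →
      ReprQ1.HasDims k (ReprQ1.E1 k m) (ReprQ1.E4 k n) (m - n) 0 ∧
      ReprQ1.HasDims k (ReprQ1.E4 k n) (ReprQ1.E1 k m) 0 (m - n - 1)) ∧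
    (∀ m n : ℕ, n ≤ m →
      ReprQ1.HasDims k (ReprQ1.E2 k m) (ReprQ1.E3 k n) 0 (m - n) ∧
      ReprQ1.HasDims k (ReprQ1.E3 k n) (ReprQ1.E2 k m) (1 + m - n) 0) ∧
    (∀ m n : ℕ, m < n →
      ReprQ1.HasDims k (ReprQ1.E2 k m) (ReprQ1.E3 k n) (n - m) 0 ∧
      ReprQ1.HasDims k (ReprQ1.E3 k n) (ReprQ1.E2 k m) 0 (n - m - 1)) ∧
    (∀ m n : ℕ,
      ReprQ1.HasDims k (ReprQ1.E2 k m) (ReprQ1.E4 k n) (1 + n + m) 0 ∧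
      ReprQ1.HasDims k (ReprQ1.E4 k n) (ReprQ1.E2 k m) 0 (n + m + 2)) ∧
    (∀ m n : ℕ,
      ReprQ1.HasDims k (ReprQ1.E3 k m) (ReprQ1.E4 k n) (n + m) 0 ∧
      ReprQ1.HasDims k (ReprQ1.E4 k n) (ReprQ1.E3 k m) 0 (n + m + 2)) ∧
    (∀ m : ℕ,
      ReprQ1.HasDims k (ReprQ1.M k) (ReprQ1.E1 k m) 0 0 ∧
      ReprQ1.HasDims k (ReprQ1.E1 k m) (ReprQ1.M k) 0 1) ∧
    (∀ m : ℕ,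
      ReprQ1.HasDims k (ReprQ1.M k) (ReprQ1.E2 k m) 0 0 ∧
      ReprQ1.HasDims k (ReprQ1.E2 k m) (ReprQ1.M k) 1 0) ∧
    (∀ m : ℕ,
      ReprQ1.HasDims k (ReprQ1.M k) (ReprQ1.E3 k m) 0 1 ∧
      ReprQ1.HasDims k (ReprQ1.E3 k m) (ReprQ1.M k) 0 0) ∧
    (∀ m : ℕ,
      ReprQ1.HasDims k (ReprQ1.M k) (ReprQ1.E4 k m) 1 0 ∧
      ReprQ1.HasDims k (ReprQ1.E4 k m) (ReprQ1.M k) 0 0) ∧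
    (∀ m : ℕ,
      ReprQ1.HasDims k (ReprQ1.M' k) (ReprQ1.E1 k m) 1 0 ∧
      ReprQ1.HasDims k (ReprQ1.E1 k m) (ReprQ1.M' k) 0 0) ∧
    (∀ m : ℕ,
      ReprQ1.HasDims k (ReprQ1.M' k) (ReprQ1.E2 k m) 0 1 ∧
      ReprQ1.HasDims k (ReprQ1.E2 k m) (ReprQ1.M' k) 0 0) ∧
    (∀ m : ℕ,
      ReprQ1.HasDims k (ReprQ1.M' k) (ReprQ1.E3 k m) 0 0 ∧
      ReprQ1.HasDims k (ReprQ1.E3 k m) (ReprQ1.M' k) 1 0) ∧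
    (∀ m : ℕ,
      ReprQ1.HasDims k (ReprQ1.M' k) (ReprQ1.E4 k m) 0 0 ∧
      ReprQ1.HasDims k (ReprQ1.E4 k m) (ReprQ1.M' k) 0 1) ∧
    (ReprQ1.HasDims k (ReprQ1.M k) (ReprQ1.M' k) 0 1 ∧
      ReprQ1.HasDims k (ReprQ1.M' k) (ReprQ1.M k) 0 1) := by
  have : Infinite k := inferInstance
  refine ⟨ReprQ1.isExceptional_iff_isListed, fun X Y hX ⟨i⟩ =>
    ((ReprQ1.isExceptional_iff X).1 hX).of_iso (Iso.refl X) i,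
    fun m n h => ⟨(ReprQ1.hasDims_E1_E1 k m n).congr (by omega) (by omega),
      (ReprQ1.hasDims_E1_E1 k n m).congr (by omega) (by omega)⟩,
    fun m n h => ⟨(ReprQ1.hasDims_E2_E2 k m n).congr (by omega) (by omega),
      (ReprQ1.hasDims_E2_E2 k n m).congr (by omega) (by omega)⟩,
    fun m n h => ⟨(ReprQ1.hasDims_E3_E3 k m n).congr (by omega) (by omega),
      (ReprQ1.hasDims_E3_E3 k n m).congr (by omega) (by omega)⟩,
    fun m n h => ⟨(ReprQ1.hasDims_E4_E4 k m n).congr (by omega) (by omega),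
      (ReprQ1.hasDims_E4_E4 k n m).congr (by omega) (by omega)⟩,
    fun m n => ⟨(ReprQ1.hasDims_E1_E2 k m n).congr (by omega) (by omega),
      (ReprQ1.hasDims_E2_E1 k n m).congr (by omega) (by omega)⟩,
    fun m n => ⟨(ReprQ1.hasDims_E1_E3 k m n).congr (by omega) (by omega),
      (ReprQ1.hasDims_E3_E1 k n m).congr (by omega) (by omega)⟩,
    fun m n h => ⟨(ReprQ1.hasDims_E1_E4 k m n).congr (by omega) (by omega),
      (ReprQ1.hasDims_E4_E1 k n m).congr (by omega) (by omega)⟩,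
    fun m n h => ⟨(ReprQ1.hasDims_E1_E4 k m n).congr (by omega) (by omega),
      (ReprQ1.hasDims_E4_E1 k n m).congr (by omega) (by omega)⟩,
    fun m n h => ⟨(ReprQ1.hasDims_E2_E3 k m n).congr (by omega) (by omega),
      (ReprQ1.hasDims_E3_E2 k n m).congr (by omega) (by omega)⟩,
    fun m n h => ⟨(ReprQ1.hasDims_E2_E3 k m n).congr (by omega) (by omega),
      (ReprQ1.hasDims_E3_E2 k n m).congr (by omega) (by omega)⟩,
    fun m n => ⟨(ReprQ1.hasDims_E2_E4 k m n).congr (by omega) (by omega),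
      (ReprQ1.hasDims_E4_E2 k n m).congr (by omega) (by omega)⟩,
    fun m n => ⟨(ReprQ1.hasDims_E3_E4 k m n).congr (by omega) (by omega),
      (ReprQ1.hasDims_E4_E3 k n m).congr (by omega) (by omega)⟩,
    fun m => ⟨ReprQ1.hasDims_M_E1 k m, ReprQ1.hasDims_E1_M k m⟩,
    fun m => ⟨ReprQ1.hasDims_M_E2 k m, ReprQ1.hasDims_E2_M k m⟩,
    fun m => ⟨ReprQ1.hasDims_M_E3 k m, ReprQ1.hasDims_E3_M k m⟩,
    fun m => ⟨ReprQ1.hasDims_M_E4 k m, ReprQ1.hasDims_E4_M k m⟩,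
    fun m => ⟨ReprQ1.hasDims_M'_E1 k m, ReprQ1.hasDims_E1_M' k m⟩,
    fun m => ⟨ReprQ1.hasDims_M'_E2 k m, ReprQ1.hasDims_E2_M' k m⟩,
    fun m => ⟨ReprQ1.hasDims_M'_E3 k m, ReprQ1.hasDims_E3_M' k m⟩,
    fun m => ⟨ReprQ1.hasDims_M'_E4 k m, ReprQ1.hasDims_E4_M' k m⟩,
    ReprQ1.hasDims_M_M' k, ReprQ1.hasDims_M'_M k⟩
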